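/- **Proposition 4.2.** For real $\alpha,\beta>-1$ let $d\mu_{\alpha,\beta}(x)=(1-x)^\alpha(1+x)^\beta\,dx$ on $(-1,1)$, and for $n=0,1,2,\dots$ let $P_n^{(\alpha,\beta)}$ be the Jacobi polynomial determined by Rodrigues' formula $$(1-x)^{\alpha}(1+x)^{\beta}P_n^{(\alpha,\beta)}(x)=\frac{(-1)^n}{2^n\,n!}\frac{d^n}{dx^n}\Big((1-x)^{\alpha+n}(1+x)^{\beta+n}\Big),\qquad -1<x<1.$$ Let $p_n^{(\alpha,\beta)}=P_n^{(\alpha,\beta)}/\|P_n^{(\alpha,\beta)}\|_{L^2((-1,1),d\mu_{\alpha,\beta})}$ be the orthonormal Jacobi polynomials, and define the Riesz kernel $$R(m,n)=\int_{-1}^{1}(1-x)^{1/2}\,p_m^{(\alpha,\beta)}(x)\,p_n^{(\alpha+1,\beta)}(x)\,d\mu_{\alpha,\beta}(x),\qquad m,n\in\{0,1,2,\dots\}.$$ If $\alpha,\beta\ge-1/2$, then there is a constant $C>0$, depending only on $\alpha$ and $\beta$, such that for all integers $m,n\ge0$ with $n\ne m$ and $m/2\le n\le 3m/2$, $$|R(m+2,n)-R(m,n)|\le\frac{C}{|m-n|^{2}}\qquad\text{and}\qquad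 |R(m,n+2)-R(m,n)|\le\frac{C}{|m-n|^{2}}.$$ -/

import Mathlib

open MeasureTheory

noncomputable section

namespace JacobiRiesz

/-- The measure `dμ_{α,β}(x) = (1 - x)^α (1 + x)^β dx` on the interval `(-1, 1)`
(the endpoints are Lebesgue-null). -/
def jacobiMeasure (α β : ℝ) : Measure ℝ :=
  (volume.restrict (Set.Ioo (-1 : ℝ) 1)).withDensity
    fun x => ENNReal.ofReal ((1 - x) ^ α * (1 + x) ^ β)

/-- The Jacobi polynomial `P_n^{(α,β)}` as a function on `(-1, 1)`, given by Rodrigues' formula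
`(1-x)^α (1+x)^β P_n^{(α,β)}(x) = (-1)^n / (2^n n!) (d/dx)^n ((1-x)^(α+n) (1+x)^(β+n))`.
Only its values at `x ∈ (-1, 1)` are meaningful, and only these are used. -/
def jacobiP (α β : ℝ) (n : ℕ) (x : ℝ) : ℝ :=
  ((1 - x) ^ α * (1 + x) ^ β)⁻¹ * ((-1) ^ n / (2 ^ n * (n.factorial : ℝ))) *
    iteratedDeriv n (fun y : ℝ => (1 - y) ^ (α + n) * (1 + y) ^ (β + n)) x

/-- The norm of `P_n^{(α,β)}` in `L^2((-1,1), dμ_{α,β})`. -/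
def jacobiPNorm (α β : ℝ) (n : ℕ) : ℝ :=
  Real.sqrt (∫ x, jacobiP α β n x ^ 2 ∂(jacobiMeasure α β))

/-- The orthonormal Jacobi polynomial `p_n^{(α,β)} = P_n^{(α,β)} / ‖P_n^{(α,β)}‖`. -/
def jacobip (α β : ℝ) (n : ℕ) (x : ℝ) : ℝ :=
  (jacobiPNorm α β n)⁻¹ * jacobiP α β n x

/-- The Riesz kernel
`R(m,n) = ∫_{-1}^{1} (1-x)^{1/2} p_m^{(α,β)}(x) p_n^{(α+1,β)}(x) dμ_{α,β}(x)`. -/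
def rieszKernel (α β : ℝ) (m n : ℕ) : ℝ :=
  ∫ x, (1 - x) ^ (1 / 2 : ℝ) * jacobip α β m x * jacobip (α + 1) β n x ∂(jacobiMeasure α β)

end JacobiRiesz

end

namespace JacobiRiesz

open Polynomial Set Filter Topology

/-! Write q_m = p_m^{(α,β)}, r_n = p_n^{(α+1,β)} and w_{a,b} for the Jacobi weight, so that R(m,n) =
∫ q_m r_n w_{α+1/2,β}. Each family solves a Jacobi equation, and w_{α+1/2,β} lies halfway between
the two orthogonality weights. Lagrange's identity (`jacobiInt_eq_edgeInt`) therefore gives R = I /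
gap, where gap(m,n) = (n-m+1/2)(n+m+α+β+3/2) and I(m,n) is `edgeInt` of q_m r_n: (α+1/2) ∫ q_m r_n
w_{α-1/2,β}, degenerating to a point evaluation at 1 when α = -1/2. Put M = m+1 and D = |m-n|+1,
with m and n comparable. Then gap is at least of order MD and I is O(M), so R is O(1/D).

The second factor 1/D comes from contiguity: q_{n+1} = d_{n+1} r_{n+1} - o_n r_n and (1-x) r_m = d_m
q_m - o_m q_{m+1}, where d_n and o_n are 1/√2 + O(1/n). Hence d_{n+1} I(m,n+1) - o_n I(m,n) is the
edge functional of q_m q_{n+1}, and d_m I(m,n) - o_m I(m+1,n) is (α+1/2) ∫ r_m r_n w_{α+1/2,β}. Both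
are O(M/D), a factor D better than the bound on I. The quotient estimate `abs_div_sub_div_le` turns
this into O(1/D²) for a shift of one index by one, and two such shifts give the theorem.

The size bounds come from expanding both factors in the orthonormal family of a smaller weight
w_{e,b} and applying Parseval. The connection coefficients are explicit and nonnegative, Gamma
ratios bound them (`exists_abs_coeff_le`), and what remains is a discrete Beta integral
(`exists_sum_beta_le`). -/

/-! ### Rodrigues' formula and the Jacobi polynomials -/

/-- The raising operator `g ↦ w_{a,b}⁻¹ (w_{a+1,b+1} g)'` of the Jacobi weights. -/
noncomputable def raise (a b : ℝ) (g : ℝ[X]) : ℝ[X] :=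
  (1 - X ^ 2) * derivative g + (C (b + 1) * (1 - X) - C (a + 1) * (1 + X)) * g

/-- The polynomial `w_{a,b}⁻¹ (d/dx)^n w_{a+n,b+n}`. -/
noncomputable def rodrigues : ℕ → ℝ → ℝ → ℝ[X]
  | 0, _, _ => 1
  | n + 1, a, b => raise a b (rodrigues n (a + 1) (b + 1))

lemma hasDerivAt_weight_mul (a b : ℝ) (g : ℝ[X]) {x : ℝ} (hx : x ∈ Ioo (-1 : ℝ) 1) :
    HasDerivAt (fun y : ℝ => (1 - y) ^ (a + 1) * (1 + y) ^ (b + 1) * g.eval y)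
      ((1 - x) ^ a * (1 + x) ^ b * (raise a b g).eval x) x := by
  have h1 : 0 < 1 - x := by linarith [hx.2]
  have h2 : 0 < 1 + x := by linarith [hx.1]
  have d1 : HasDerivAt (fun y : ℝ => (1 - y) ^ (a + 1)) (-1 * (a + 1) * (1 - x) ^ a) x := by
    have := ((hasDerivAt_id x).const_sub 1).rpow_const (p := a + 1) (Or.inl h1.ne')
    simpa using this
  have d2 : HasDerivAt (fun y : ℝ => (1 + y) ^ (b + 1)) (1 * (b + 1) * (1 + x) ^ b) x := by
    have := ((hasDerivAt_id x).const_add 1).rpow_const (p := b + 1) (Or.inl h2.ne')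
    simpa using this
  have := (d1.mul d2).mul (g.hasDerivAt x)
  refine this.congr_deriv ?_
  simp only [raise, eval_add, eval_mul, eval_sub, eval_one, eval_pow, eval_X, eval_C, Pi.mul_apply]
  rw [Real.rpow_add h1, Real.rpow_add h2, Real.rpow_one, Real.rpow_one]
  ring

lemma iteratedDeriv_weight (n : ℕ) : ∀ (a b : ℝ), ∀ x ∈ Ioo (-1 : ℝ) 1,
    iteratedDeriv n (fun y : ℝ => (1 - y) ^ (a + n) * (1 + y) ^ (b + n)) x =
      (1 - x) ^ a * (1 + x) ^ b * (rodrigues n a b).eval x := by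
  induction n with
  | zero => intro a b x _; simp [rodrigues]
  | succ n ih =>
    intro a b x hx
    have e : (fun y : ℝ => (1 - y) ^ (a + (n + 1 : ℕ)) * (1 + y) ^ (b + (n + 1 : ℕ))) =
        fun y : ℝ => (1 - y) ^ (a + 1 + n) * (1 + y) ^ (b + 1 + n) := by
      ext y
      have h (c : ℝ) : c + (n + 1 : ℕ) = c + 1 + n := by push_cast; ring
      rw [h, h]
    rw [e, iteratedDeriv_succ, rodrigues, ← (hasDerivAt_weight_mul a b _ hx).deriv]
    apply Filter.EventuallyEq.deriv_eq
    filter_upwards [isOpen_Ioo.mem_nhds hx] with y hy using ih (a + 1) (b + 1) y hy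

/-- The Jacobi polynomial as an honest polynomial. -/
noncomputable def jacobiPoly (a b : ℝ) (n : ℕ) : ℝ[X] :=
  C ((-1) ^ n / (2 ^ n * (n.factorial : ℝ))) * rodrigues n a b

lemma jacobiP_eq (a b : ℝ) (n : ℕ) {x : ℝ} (hx : x ∈ Ioo (-1 : ℝ) 1) :
    jacobiP a b n x = (jacobiPoly a b n).eval x := by
  have h1 : 0 < 1 - x := by linarith [hx.2]
  have h2 : 0 < 1 + x := by linarith [hx.1]
  have := (mul_pos (Real.rpow_pos_of_pos h1 a) (Real.rpow_pos_of_pos h2 b)).ne'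
  rw [jacobiP, iteratedDeriv_weight n a b x hx, jacobiPoly, eval_mul, eval_C]
  field_simp

/-! ### Integration against Jacobi weights -/

/-- Integration of a polynomial against `w_{a,b}`. -/
noncomputable def jacobiInt (a b : ℝ) (g : ℝ[X]) : ℝ :=
  ∫ x in (-1 : ℝ)..1, (1 - x) ^ a * (1 + x) ^ b * g.eval x

lemma intervalIntegrable_weight {a b : ℝ} (ha : -1 < a) (hb : -1 < b) (g : ℝ[X]) :
    IntervalIntegrable (fun x : ℝ => (1 - x) ^ a * (1 + x) ^ b * g.eval x) volume (-1) 1 := by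
  refine IntervalIntegrable.mul_continuousOn ?_ g.continuous.continuousOn
  -- Cutting at 0 leaves one singular factor on each half; the other is continuous there.
  refine IntervalIntegrable.trans (b := 0) ?_ ?_
  · refine IntervalIntegrable.continuousOn_mul ?_ ?_
    · have := (intervalIntegral.intervalIntegrable_rpow' (a := 0) (b := 1) hb).comp_add_left 1
      simpa using this
    · refine ContinuousOn.rpow_const (by fun_prop) fun x hx => Or.inl ?_
      rw [uIcc_of_le (by norm_num)] at hx
      linarith [hx.2]
  · refine IntervalIntegrable.mul_continuousOn ?_ ?_
    · have := ((intervalIntegral.intervalIntegrable_rpow' (a := 0) (b := 1) ha).comp_sub_left 1).symm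
      simpa using this
    · refine ContinuousOn.rpow_const (by fun_prop) fun x hx => Or.inl ?_
      rw [uIcc_of_le (by norm_num)] at hx
      linarith [hx.1]

lemma jacobiInt_add {a b : ℝ} (ha : -1 < a) (hb : -1 < b) (f g : ℝ[X]) :
    jacobiInt a b (f + g) = jacobiInt a b f + jacobiInt a b g := by
  simp only [jacobiInt, eval_add, mul_add]
  exact intervalIntegral.integral_add (intervalIntegrable_weight ha hb f)
    (intervalIntegrable_weight ha hb g)

lemma jacobiInt_C_mul (a b c : ℝ) (g : ℝ[X]) :
    jacobiInt a b (C c * g) = c * jacobiInt a b g := by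
  simp only [jacobiInt, eval_mul, eval_C, ← intervalIntegral.integral_const_mul]
  congr 1; ext x; ring

lemma jacobiInt_neg (a b : ℝ) (g : ℝ[X]) : jacobiInt a b (-g) = -jacobiInt a b g := by
  have := jacobiInt_C_mul a b (-1) g
  simpa using this

lemma jacobiInt_sub {a b : ℝ} (ha : -1 < a) (hb : -1 < b) (f g : ℝ[X]) :
    jacobiInt a b (f - g) = jacobiInt a b f - jacobiInt a b g := by
  rw [sub_eq_add_neg, jacobiInt_add ha hb, jacobiInt_neg, sub_eq_add_neg]

lemma jacobiInt_sum {ι : Type*} {a b : ℝ} (ha : -1 < a) (hb : -1 < b) (s : Finset ι)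
    (f : ι → ℝ[X]) : jacobiInt a b (∑ i ∈ s, f i) = ∑ i ∈ s, jacobiInt a b (f i) := by
  classical
  induction s using Finset.induction_on with
  | empty => simp [jacobiInt]
  | insert i s hi ih => rw [Finset.sum_insert hi, Finset.sum_insert hi, jacobiInt_add ha hb, ih]

lemma jacobiInt_congr {a b a' b' : ℝ} {f g : ℝ[X]}
    (h : ∀ x ∈ Ioo (-1 : ℝ) 1, (1 - x) ^ a * (1 + x) ^ b * f.eval x =
      (1 - x) ^ a' * (1 + x) ^ b' * g.eval x) : jacobiInt a b f = jacobiInt a' b' g := by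
  unfold jacobiInt
  rw [intervalIntegral.integral_of_le (by norm_num), intervalIntegral.integral_of_le (by norm_num),
    integral_Ioc_eq_integral_Ioo, integral_Ioc_eq_integral_Ioo]
  exact setIntegral_congr_fun measurableSet_Ioo h

lemma jacobiInt_one_sub_mul (a b : ℝ) (g : ℝ[X]) :
    jacobiInt a b ((1 - X) * g) = jacobiInt (a + 1) b g := by
  refine jacobiInt_congr fun x hx => ?_
  rw [Real.rpow_add (by linarith [hx.2]), Real.rpow_one]
  simp only [eval_mul, eval_sub, eval_one, eval_X]; ring

lemma jacobiInt_one_add_mul (a b : ℝ) (g : ℝ[X]) :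
    jacobiInt a b ((1 + X) * g) = jacobiInt a (b + 1) g := by
  refine jacobiInt_congr fun x hx => ?_
  rw [Real.rpow_add (x := 1 + x) (by linarith [hx.1]), Real.rpow_one]
  simp only [eval_mul, eval_add, eval_one, eval_X]; ring

/-- The integrand is the derivative of w_{a+1,b+1} g, which vanishes at both endpoints because a+1
and b+1 are positive. -/
lemma jacobiInt_raise {a b : ℝ} (ha : -1 < a) (hb : -1 < b) (g : ℝ[X]) :
    jacobiInt a b (raise a b g) = 0 := by
  have ha' : 0 < a + 1 := by linarith
  have hb' : 0 < b + 1 := by linarith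
  have := intervalIntegral.integral_eq_sub_of_hasDerivAt_of_le (a := -1) (b := 1) (by norm_num)
    (f := fun y : ℝ => (1 - y) ^ (a + 1) * (1 + y) ^ (b + 1) * g.eval y) ?_
    (fun x hx => hasDerivAt_weight_mul a b g hx) (intervalIntegrable_weight ha hb _)
  · rw [jacobiInt, this]
    simp [Real.zero_rpow ha'.ne', Real.zero_rpow hb'.ne']
  · refine ContinuousOn.mul (ContinuousOn.mul ?_ ?_) g.continuous.continuousOn
    · exact ContinuousOn.rpow_const (by fun_prop) fun x _ => Or.inr ha'.le
    · exact ContinuousOn.rpow_const (by fun_prop) fun x _ => Or.inr hb'.le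

/-- Integration by parts: up to sign, `raise` is adjoint to differentiation between neighbouring
weights. -/
lemma jacobiInt_mul_raise {a b : ℝ} (ha : -1 < a) (hb : -1 < b) (f g : ℝ[X]) :
    jacobiInt a b (f * raise a b g) = -jacobiInt (a + 1) (b + 1) (derivative f * g) := by
  have e : raise a b (f * g) = f * raise a b g + (1 - X) * ((1 + X) * (derivative f * g)) := by
    simp only [raise, derivative_mul]; ring
  have := jacobiInt_raise ha hb (f * g)
  rw [e, jacobiInt_add ha hb, jacobiInt_one_sub_mul, jacobiInt_one_add_mul] at this
  linarith

lemma jacobiInt_mul_rodrigues (n : ℕ) : ∀ {a b : ℝ}, -1 < a → -1 < b → ∀ f : ℝ[X],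
    jacobiInt a b (f * rodrigues n a b) =
      (-1) ^ n * jacobiInt (a + n) (b + n) (derivative^[n] f) := by
  induction n with
  | zero => intro a b _ _ f; simp [rodrigues]
  | succ n ih =>
    intro a b ha hb f
    rw [rodrigues, jacobiInt_mul_raise ha hb, ih (by linarith) (by linarith),
      Function.iterate_succ_apply]
    have h (c : ℝ) : c + (n + 1 : ℕ) = c + 1 + n := by push_cast; ring
    rw [h, h]
    ring

lemma jacobiInt_one {a b : ℝ} (ha : -1 < a) (hb : -1 < b) :
    jacobiInt a b 1 = 2 ^ (a + b + 1) *
      (Real.Gamma (a + 1) * Real.Gamma (b + 1) / Real.Gamma (a + b + 2)) := by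
  have hG := ProbabilityTheory.beta_eq_betaIntegralReal (b + 1) (a + 1) (by linarith) (by linarith)
  have hre : (Complex.betaIntegral ((b + 1 : ℝ) : ℂ) ((a + 1 : ℝ) : ℂ)).re =
      ∫ x in (0 : ℝ)..1, x ^ b * (1 - x) ^ a := by
    have : Complex.betaIntegral ((b + 1 : ℝ) : ℂ) ((a + 1 : ℝ) : ℂ) =
        ((∫ x in (0 : ℝ)..1, x ^ b * (1 - x) ^ a : ℝ) : ℂ) := by
      rw [Complex.betaIntegral, ← intervalIntegral.integral_ofReal]
      refine intervalIntegral.integral_congr fun x hx => ?_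
      rw [uIcc_of_le (by norm_num)] at hx
      have h1 : (0 : ℝ) ≤ 1 - x := by linarith [hx.2]
      push_cast [Complex.ofReal_cpow hx.1, Complex.ofReal_cpow h1]
      simp
    rw [this, Complex.ofReal_re]
  rw [hre] at hG
  have hsub : jacobiInt a b 1 = 2 * ∫ x in (0 : ℝ)..1,
      (1 - (2 * x - 1)) ^ a * (1 + (2 * x - 1)) ^ b * eval (2 * x - 1) (1 : ℝ[X]) := by
    have := intervalIntegral.mul_integral_comp_mul_sub (a := 0) (b := 1)
      (f := fun x : ℝ => (1 - x) ^ a * (1 + x) ^ b * eval x (1 : ℝ[X])) 2 1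
    rw [this, jacobiInt]; norm_num
  have hscale : ∫ x in (0 : ℝ)..1,
      (1 - (2 * x - 1)) ^ a * (1 + (2 * x - 1)) ^ b * eval (2 * x - 1) (1 : ℝ[X]) =
      2 ^ (a + b) * ∫ x in (0 : ℝ)..1, x ^ b * (1 - x) ^ a := by
    rw [← intervalIntegral.integral_const_mul]
    refine intervalIntegral.integral_congr fun x hx => ?_
    rw [uIcc_of_le (by norm_num)] at hx
    have h1 : (0 : ℝ) ≤ 1 - x := by linarith [hx.2]
    have e1 : (1 - (2 * x - 1)) = 2 * (1 - x) := by ring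
    have e2 : (1 + (2 * x - 1)) = 2 * x := by ring
    simp only [e1, e2, eval_one]
    rw [Real.mul_rpow zero_le_two h1, Real.mul_rpow zero_le_two hx.1, Real.rpow_add two_pos]
    ring
  rw [hsub, hscale, ← hG, ProbabilityTheory.beta, show b + 1 + (a + 1) = a + b + 2 by ring,
    Real.rpow_add two_pos (a + b) 1, Real.rpow_one]
  ring

/-! ### Lowering, raising and the Jacobi equation -/

lemma derivative_raise (a b : ℝ) (g : ℝ[X]) :
    derivative (raise a b g) = raise (a + 1) (b + 1) (derivative g) - C (a + b + 2) * g := by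
  simp only [raise, derivative_mul, derivative_sub, derivative_one, derivative_X, derivative_C,
    derivative_X_pow, map_add, map_one, map_ofNat, Nat.cast_ofNat]
  ring

lemma raise_C_mul (a b c : ℝ) (g : ℝ[X]) : raise a b (C c * g) = C c * raise a b g := by
  simp only [raise, derivative_C_mul]; ring

/-- Induction on the commutation rule `derivative_raise`: both of its terms are multiples of the
same polynomial, and the scalars add up. -/
lemma derivative_rodrigues (n : ℕ) : ∀ a b : ℝ, derivative (rodrigues (n + 1) a b) =
    C (-((n + 1) * (n + a + b + 2))) * rodrigues n (a + 1) (b + 1) := by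
  induction n with
  | zero =>
    intro a b
    rw [rodrigues.eq_2, derivative_raise]
    simp [rodrigues, raise]
  | succ n ih =>
    intro a b
    rw [rodrigues, derivative_raise, ih, raise_C_mul]
    conv_lhs => rw [← rodrigues.eq_2]
    rw [← sub_mul, ← C_sub]
    congr 2
    push_cast; ring

/-- The Jacobi differential equation, obtained by lowering and then raising. -/
lemma raise_derivative_rodrigues (n : ℕ) (a b : ℝ) :
    raise a b (derivative (rodrigues n a b)) = C (-(n * (n + a + b + 1))) * rodrigues n a b := by
  cases n with
  | zero => simp [rodrigues, raise]
  | succ n =>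
    rw [derivative_rodrigues, raise_C_mul, rodrigues]
    congr 2
    push_cast; ring

lemma ascPochhammer_eval_succ_left (z : ℝ) (n : ℕ) :
    (ascPochhammer ℝ (n + 1)).eval z = z * (ascPochhammer ℝ n).eval (z + 1) := by
  rw [ascPochhammer_succ_left]; simp

lemma Gamma_add_nat_eq {z : ℝ} (hz : 0 < z) (n : ℕ) :
    Real.Gamma (z + n) = (ascPochhammer ℝ n).eval z * Real.Gamma z := by
  induction n with
  | zero => simp
  | succ n ih =>
    rw [ascPochhammer_succ_eval, Nat.cast_succ, ← add_assoc, Real.Gamma_add_one (by positivity), ih]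
    ring

lemma iterate_derivative_rodrigues (k j : ℕ) : ∀ a b : ℝ,
    derivative^[k] (rodrigues (j + k) a b) =
      C ((-1) ^ k * ((j + k).factorial / j.factorial) *
        (ascPochhammer ℝ k).eval (j + k + a + b + 1)) * rodrigues j (a + k) (b + k) := by
  induction k with
  | zero =>
    intro a b
    have : (j.factorial : ℝ) ≠ 0 := by positivity
    simp [this]
  | succ k ih =>
    intro a b
    have h (c : ℝ) : c + (k + 1 : ℕ) = c + 1 + k := by push_cast; ring
    rw [Function.iterate_succ_apply, ← add_assoc, derivative_rodrigues, iterate_derivative_C_mul,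
      ih, ← mul_assoc, ← C_mul, h a, h b, ascPochhammer_eval_succ_left, Nat.factorial_succ]
    congr 2
    rw [show (j : ℝ) + (k + 1 : ℕ) + a + b + 1 = j + k + a + b + 2 by push_cast; ring,
      show (j : ℝ) + k + (a + 1) + (b + 1) + 1 = j + k + a + b + 2 + 1 by ring]
    push_cast; ring

lemma natDegree_raise_le (a b : ℝ) (g : ℝ[X]) : (raise a b g).natDegree ≤ g.natDegree + 1 := by
  unfold raise
  refine (natDegree_add_le _ _).trans (max_le ?_ ?_)
  · rcases Nat.eq_zero_or_pos g.natDegree with h | h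
    · rw [eq_C_of_natDegree_eq_zero h]; simp
    · refine natDegree_mul_le.trans ?_
      have h1 := natDegree_derivative_le g
      have h2 : (1 - X ^ 2 : ℝ[X]).natDegree ≤ 2 := by compute_degree
      omega
  · refine natDegree_mul_le.trans ?_
    have h2 : (C (b + 1) * (1 - X) - C (a + 1) * (1 + X) : ℝ[X]).natDegree ≤ 1 := by
      compute_degree
    omega

lemma natDegree_rodrigues_le (n : ℕ) : ∀ a b : ℝ, (rodrigues n a b).natDegree ≤ n := by
  induction n with
  | zero => intro a b; simp [rodrigues]
  | succ n ih =>
    intro a b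
    exact (natDegree_raise_le _ _ _).trans (Nat.succ_le_succ (ih _ _))

/-- The n-th derivative is a constant, equal to n! times this coefficient. -/
lemma coeff_rodrigues (n : ℕ) (a b : ℝ) :
    (rodrigues n a b).coeff n = (-1) ^ n * (ascPochhammer ℝ n).eval (n + a + b + 1) := by
  have h := congrArg (fun p => p.coeff 0) (iterate_derivative_rodrigues n 0 a b)
  simp only [zero_add, coeff_iterate_derivative, rodrigues, mul_one, coeff_C_zero,
    Nat.descFactorial_self, nsmul_eq_mul, Nat.factorial_zero, Nat.cast_one, div_one,
    Nat.cast_zero] at h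
  have : (n.factorial : ℝ) ≠ 0 := by positivity
  refine mul_left_cancel₀ this (h.trans ?_)
  ring

/-! ### Connection integrals and norms -/

/-- Raising with parameter e+s is raising with parameter e minus s(1+x). The first part integrates
to zero, so each step contributes a factor -s, absorbs 1+x into the weight and replaces s by s+1. -/
lemma jacobiInt_rodrigues_shift (j : ℕ) {e : ℝ} (he : -1 < e) : ∀ {b : ℝ}, -1 < b → ∀ s : ℝ,
    jacobiInt e b (rodrigues j (e + s) b) =
      (-1) ^ j * (ascPochhammer ℝ j).eval s * jacobiInt e (b + j) 1 := by
  induction j with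
  | zero => intro b _ s; simp [rodrigues]
  | succ j ih =>
    intro b hb s
    have e1 (g : ℝ[X]) : raise (e + s) b g = raise e b g - C s * ((1 + X) * g) := by
      simp only [raise, map_add]; ring
    rw [rodrigues, e1, jacobiInt_sub he hb, jacobiInt_raise he hb, jacobiInt_C_mul,
      jacobiInt_one_add_mul, add_assoc, ih (by linarith), ascPochhammer_eval_succ_left,
      Nat.cast_succ, show b + 1 + (j : ℝ) = b + (j + 1) by ring]
    ring

/-- The connection integral between `P_{j+k}^{(e+s,b)}` and `P_k^{(e,b)}`. -/
noncomputable def conn (e b s : ℝ) (j k : ℕ) : ℝ :=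
  2 ^ (e + b + 1) * ((ascPochhammer ℝ j).eval s / j.factorial) *
    ((ascPochhammer ℝ k).eval (j + k + (e + s) + b + 1) / k.factorial) *
    (Real.Gamma (e + k + 1) * Real.Gamma (b + (j + k) + 1) / Real.Gamma (e + b + j + 2 * k + 2))

/-- Rodrigues' formula for the second factor moves k derivatives onto the first, leaving degree j
with parameters (e+s+k, b+k). The shift formula in the weight w_{e+k,b+k} then reduces everything to
a Beta integral. -/
lemma jacobiInt_jacobiPoly_mul {e b : ℝ} (he : -1 < e) (hb : -1 < b) (s : ℝ) (j k : ℕ) :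
    jacobiInt e b (jacobiPoly (e + s) b (j + k) * jacobiPoly e b k) = conn e b s j k := by
  have hk : (0 : ℝ) ≤ k := by positivity
  have hj : (0 : ℝ) ≤ j := by positivity
  have e1 : jacobiPoly (e + s) b (j + k) * jacobiPoly e b k =
      C ((-1) ^ (j + k) / (2 ^ (j + k) * ((j + k).factorial : ℝ)) *
        ((-1) ^ k / (2 ^ k * (k.factorial : ℝ)))) *
        (rodrigues (j + k) (e + s) b * rodrigues k e b) := by
    rw [jacobiPoly, jacobiPoly, C_mul]; ring
  rw [e1, jacobiInt_C_mul, jacobiInt_mul_rodrigues k he hb, iterate_derivative_rodrigues,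
    jacobiInt_C_mul, show e + s + (k : ℝ) = e + k + s by ring,
    jacobiInt_rodrigues_shift j (by linarith) (by linarith),
    jacobiInt_one (by linarith) (by linarith), conn,
    show e + k + (b + k + j) + 1 = e + b + 1 + (j + k : ℕ) + (k : ℕ) by push_cast; ring,
    Real.rpow_add_natCast two_ne_zero, Real.rpow_add_natCast two_ne_zero,
    show e + k + (b + k + j) + 2 = e + b + j + 2 * k + 2 by ring,
    show b + k + j + 1 = b + (j + k) + 1 by ring]
  have h1 : ((j + k).factorial : ℝ) ≠ 0 := by positivity
  have h2 : (j.factorial : ℝ) ≠ 0 := by positivity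
  have h3 : (k.factorial : ℝ) ≠ 0 := by positivity
  have h4 : (-1 : ℝ) ^ (j + k) * (-1) ^ k * ((-1) ^ k * ((-1) ^ k * (-1) ^ j)) = 1 := by
    rw [pow_add]
    have hx : ((-1 : ℝ) ^ k) ^ 2 = 1 := by rw [← pow_mul, mul_comm, pow_mul]; simp
    have hy : ((-1 : ℝ) ^ j) ^ 2 = 1 := by rw [← pow_mul, mul_comm, pow_mul]; simp
    linear_combination ((-1) ^ k) ^ 2 * ((-1) ^ j) ^ 2 * hx + ((-1) ^ j) ^ 2 * hx + hy
  generalize Real.Gamma (e + k + 1) * Real.Gamma (b + (j + k) + 1) /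
    Real.Gamma (e + b + j + 2 * k + 2) = G
  generalize (ascPochhammer ℝ k).eval (j + k + (e + s) + b + 1) = p
  field_simp
  linear_combination p * (ascPochhammer ℝ j).eval s * G * h4

lemma natDegree_jacobiPoly_le (a b : ℝ) (n : ℕ) : (jacobiPoly a b n).natDegree ≤ n :=
  (natDegree_C_mul_le _ _).trans (natDegree_rodrigues_le n a b)

lemma jacobiInt_mul_jacobiPoly_eq_zero {a b : ℝ} (ha : -1 < a) (hb : -1 < b) {g : ℝ[X]} {n : ℕ}
    (hg : g.natDegree < n) : jacobiInt a b (g * jacobiPoly a b n) = 0 := by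
  rw [jacobiPoly, mul_left_comm, jacobiInt_C_mul, jacobiInt_mul_rodrigues n ha hb,
    iterate_derivative_eq_zero hg]
  simp [jacobiInt]

/-- The squared norm of `P_n^{(a,b)}`. -/
noncomputable def normSq (a b : ℝ) (n : ℕ) : ℝ := conn a b 0 0 n

lemma jacobiInt_jacobiPoly_sq {a b : ℝ} (ha : -1 < a) (hb : -1 < b) (n : ℕ) :
    jacobiInt a b (jacobiPoly a b n * jacobiPoly a b n) = normSq a b n := by
  have := jacobiInt_jacobiPoly_mul ha hb 0 0 n
  rw [add_zero, zero_add] at this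
  exact this

lemma ascPochhammer_eval_pos {a b : ℝ} (hab : -2 < a + b) (n : ℕ) :
    0 < (ascPochhammer ℝ n).eval (n + a + b + 1) := by
  cases n with
  | zero => simp
  | succ n => exact ascPochhammer_pos _ _ (by push_cast; linarith [(Nat.cast_nonneg n : (0 : ℝ) ≤ n)])

lemma normSq_pos {a b : ℝ} (ha : -1 < a) (hb : -1 < b) (n : ℕ) : 0 < normSq a b n := by
  have hn : (0 : ℝ) ≤ n := by positivity
  have h := ascPochhammer_eval_pos (a := a) (b := b) (by linarith) n
  have h1 := Real.Gamma_pos_of_pos (s := a + n + 1) (by linarith)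
  have h2 := Real.Gamma_pos_of_pos (s := b + n + 1) (by linarith)
  have h3 := Real.Gamma_pos_of_pos (s := a + b + 2 * n + 2) (by linarith)
  simp only [normSq, conn, ascPochhammer_zero, eval_one, Nat.factorial_zero, Nat.cast_one,
    Nat.cast_zero, zero_add, add_zero]
  positivity

/-! ### Orthonormal families, expansion and Parseval -/

/-- The orthonormal Jacobi polynomial as an honest polynomial. -/
noncomputable def orthPoly (a b : ℝ) (n : ℕ) : ℝ[X] :=
  C (√(normSq a b n))⁻¹ * jacobiPoly a b n

lemma jacobiInt_orthPoly_mul {e b : ℝ} (he : -1 < e) (hb : -1 < b) (s : ℝ) (j k : ℕ) :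
    jacobiInt e b (orthPoly (e + s) b (j + k) * orthPoly e b k) =
      conn e b s j k / (√(normSq (e + s) b (j + k)) * √(normSq e b k)) := by
  have : orthPoly (e + s) b (j + k) * orthPoly e b k =
      C ((√(normSq (e + s) b (j + k)))⁻¹ * (√(normSq e b k))⁻¹) *
      (jacobiPoly (e + s) b (j + k) * jacobiPoly e b k) := by
    rw [orthPoly, orthPoly, C_mul]; ring
  rw [this, jacobiInt_C_mul, jacobiInt_jacobiPoly_mul he hb]
  field_simp

lemma natDegree_orthPoly_le (a b : ℝ) (n : ℕ) : (orthPoly a b n).natDegree ≤ n :=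
  (natDegree_C_mul_le _ _).trans (natDegree_jacobiPoly_le a b n)

lemma jacobiInt_mul_orthPoly_eq_zero {a b : ℝ} (ha : -1 < a) (hb : -1 < b) {g : ℝ[X]} {n : ℕ}
    (hg : g.natDegree < n) : jacobiInt a b (g * orthPoly a b n) = 0 := by
  rw [orthPoly, mul_left_comm, jacobiInt_C_mul, jacobiInt_mul_jacobiPoly_eq_zero ha hb hg, mul_zero]

lemma jacobiInt_orthPoly_sq {a b : ℝ} (ha : -1 < a) (hb : -1 < b) (n : ℕ) :
    jacobiInt a b (orthPoly a b n * orthPoly a b n) = 1 := by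
  have h := normSq_pos ha hb n
  have := jacobiInt_orthPoly_mul ha hb 0 0 n
  rw [add_zero, zero_add] at this
  rw [this, Real.mul_self_sqrt h.le]
  exact div_self h.ne'

lemma jacobiInt_orthPoly_ne {a b : ℝ} (ha : -1 < a) (hb : -1 < b) {m n : ℕ} (h : m ≠ n) :
    jacobiInt a b (orthPoly a b m * orthPoly a b n) = 0 := by
  rcases h.lt_or_gt with h | h
  · exact jacobiInt_mul_orthPoly_eq_zero ha hb ((natDegree_orthPoly_le a b m).trans_lt h)
  · rw [mul_comm]
    exact jacobiInt_mul_orthPoly_eq_zero ha hb ((natDegree_orthPoly_le a b n).trans_lt h)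

lemma coeff_orthPoly_ne_zero {a b : ℝ} (ha : -1 < a) (hb : -1 < b) (n : ℕ) :
    (orthPoly a b n).coeff n ≠ 0 := by
  have h := normSq_pos ha hb n
  have h2 := ascPochhammer_eval_pos (a := a) (b := b) (by linarith) n
  rw [orthPoly, jacobiPoly, coeff_C_mul, coeff_C_mul, coeff_rodrigues]
  have : √(normSq a b n) ≠ 0 := (Real.sqrt_pos.2 h).ne'
  positivity

lemma exists_eq_sum_orthPoly {a b : ℝ} (ha : -1 < a) (hb : -1 < b) (N : ℕ) : ∀ g : ℝ[X],
    g.natDegree < N → ∃ c : ℕ → ℝ, g = ∑ k ∈ Finset.range N, C (c k) * orthPoly a b k := by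
  induction N with
  | zero => intro g hg; omega
  | succ N ih =>
    intro g hg
    have hc := coeff_orthPoly_ne_zero ha hb N
    set t := g.coeff N / (orthPoly a b N).coeff N
    set r := g - C t * orthPoly a b N with hr
    have hrN : r.natDegree ≤ N := by
      refine (natDegree_sub_le _ _).trans (max_le (by omega) ?_)
      exact (natDegree_C_mul_le _ _).trans (natDegree_orthPoly_le a b N)
    have hr0 : r.coeff N = 0 := by
      rw [hr, coeff_sub, coeff_C_mul, div_mul_cancel₀ _ hc, sub_self]
    have key : ∃ c : ℕ → ℝ, r = ∑ k ∈ Finset.range N, C (c k) * orthPoly a b k := by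
      rcases eq_or_ne r 0 with h0 | h0
      · exact ⟨0, by simp [h0]⟩
      · refine ih r (lt_of_le_of_ne hrN fun h => h0 ?_)
        rw [← leadingCoeff_eq_zero, leadingCoeff, h, hr0]
    obtain ⟨c, hc'⟩ := key
    refine ⟨Function.update c N t, ?_⟩
    rw [Finset.sum_range_succ, Function.update_self]
    have : ∑ k ∈ Finset.range N, C (Function.update c N t k) * orthPoly a b k = r := by
      rw [hc']
      refine Finset.sum_congr rfl fun k hk => ?_
      rw [Function.update_of_ne (Finset.mem_range.1 hk).ne]
    rw [this, hr]; ring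

/-- Expansion of a polynomial in the orthonormal Jacobi polynomials. -/
lemma eq_sum_orthPoly {a b : ℝ} (ha : -1 < a) (hb : -1 < b) {N : ℕ} {g : ℝ[X]}
    (hg : g.natDegree < N) :
    g = ∑ k ∈ Finset.range N, C (jacobiInt a b (g * orthPoly a b k)) * orthPoly a b k := by
  obtain ⟨c, hc⟩ := exists_eq_sum_orthPoly ha hb N g hg
  have : ∀ k ∈ Finset.range N, jacobiInt a b (g * orthPoly a b k) = c k := by
    intro k hk
    rw [hc, Finset.sum_mul, jacobiInt_sum ha hb, Finset.sum_eq_single k]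
    · rw [mul_assoc, jacobiInt_C_mul, jacobiInt_orthPoly_sq ha hb, mul_one]
    · intro i _ hi
      rw [mul_assoc, jacobiInt_C_mul, jacobiInt_orthPoly_ne ha hb hi, mul_zero]
    · intro h; exact absurd hk h
  conv_lhs => rw [hc]
  exact Finset.sum_congr rfl fun k hk => by rw [this k hk]

/-- Parseval's identity; a degree bound on one factor suffices. -/
lemma jacobiInt_mul_eq_sum {a b : ℝ} (ha : -1 < a) (hb : -1 < b) {N : ℕ} {f : ℝ[X]} (g : ℝ[X])
    (hf : f.natDegree < N) :
    jacobiInt a b (f * g) = ∑ k ∈ Finset.range N,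
      jacobiInt a b (f * orthPoly a b k) * jacobiInt a b (g * orthPoly a b k) := by
  conv_lhs => rw [eq_sum_orthPoly ha hb hf]
  rw [Finset.sum_mul, jacobiInt_sum ha hb]
  refine Finset.sum_congr rfl fun k _ => ?_
  rw [mul_assoc, jacobiInt_C_mul, mul_comm (orthPoly a b k) g]

/-! ### The kernel as an integral of polynomials -/

lemma integral_jacobiMeasure (α β : ℝ) (f : ℝ → ℝ) :
    ∫ x, f x ∂(jacobiMeasure α β) =
      ∫ x in Ioo (-1 : ℝ) 1, (1 - x) ^ α * (1 + x) ^ β * f x := by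
  rw [jacobiMeasure, integral_withDensity_eq_integral_toReal_smul (by fun_prop)
    (by filter_upwards with x using ENNReal.ofReal_lt_top)]
  refine setIntegral_congr_fun measurableSet_Ioo fun x hx => ?_
  have h1 : 0 < 1 - x := by linarith [hx.2]
  have h2 : 0 < 1 + x := by linarith [hx.1]
  rw [ENNReal.toReal_ofReal (by positivity), smul_eq_mul]

lemma jacobiPNorm_eq {α β : ℝ} (hα : -1 < α) (hβ : -1 < β) (n : ℕ) :
    jacobiPNorm α β n = √(normSq α β n) := by
  rw [jacobiPNorm, integral_jacobiMeasure, ← jacobiInt_jacobiPoly_sq hα hβ, jacobiInt,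
    intervalIntegral.integral_of_le (by norm_num), integral_Ioc_eq_integral_Ioo]
  congr 1
  refine setIntegral_congr_fun measurableSet_Ioo fun x hx => ?_
  simp only [jacobiP_eq α β n hx, eval_mul]
  ring

lemma jacobip_eq {α β : ℝ} (hα : -1 < α) (hβ : -1 < β) (n : ℕ) {x : ℝ}
    (hx : x ∈ Ioo (-1 : ℝ) 1) : jacobip α β n x = (orthPoly α β n).eval x := by
  rw [jacobip, jacobiPNorm_eq hα hβ, jacobiP_eq α β n hx, orthPoly, eval_mul, eval_C]

lemma rieszKernel_eq {α β : ℝ} (hα : -1 < α) (hβ : -1 < β) (m n : ℕ) :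
    rieszKernel α β m n =
      jacobiInt (α + 1 / 2) β (orthPoly α β m * orthPoly (α + 1) β n) := by
  rw [rieszKernel, integral_jacobiMeasure, jacobiInt,
    intervalIntegral.integral_of_le (by norm_num), integral_Ioc_eq_integral_Ioo]
  refine setIntegral_congr_fun measurableSet_Ioo fun x hx => ?_
  have h1 : 0 < 1 - x := by linarith [hx.2]
  simp only [jacobip_eq hα hβ m hx, jacobip_eq (by linarith : -1 < α + 1) hβ n hx, eval_mul,
    Real.rpow_add h1]
  ring

/-! ### The edge functional and Lagrange's identity -/

/-- The functional `(α + 1/2) ∫ g w_{α-1/2,β}`, in a form that still makes sense at `α = -1/2`,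
where it is `2^β g(1)`. -/
noncomputable def edgeInt (α β : ℝ) (g : ℝ[X]) : ℝ :=
  jacobiInt (α + 1 / 2) β (C (α + β + 3 / 2) * g + (1 + X) * derivative g) / 2

/-- The integral of `raise (α - 1 / 2) β g` against w_{α-1/2,β} vanishes. Splitting off a factor 1-x
from that polynomial leaves a multiple of g, and the two parts are the two sides. -/
lemma edgeInt_eq {α β : ℝ} (hα : -1 / 2 < α) (hβ : -1 < β) (g : ℝ[X]) :
    edgeInt α β g = (α + 1 / 2) * jacobiInt (α - 1 / 2) β g := by
  have h1 : -1 < α - 1 / 2 := by linarith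
  have h := jacobiInt_raise h1 hβ g
  have e : raise (α - 1 / 2) β g = (1 - X) * (C (α + β + 3 / 2) * g + (1 + X) * derivative g) -
      C (2 * (α + 1 / 2)) * g := by
    simp only [raise, map_add, map_sub, map_mul, map_one]
    have : (C (1 / 2 : ℝ) : ℝ[X]) + C (1 / 2) = 1 := by rw [← C_add]; norm_num
    have h3 : (C (3 / 2 : ℝ) : ℝ[X]) = 1 + C (1 / 2) := by rw [← C_1, ← C_add]; norm_num
    have h4 : (C (2 : ℝ) : ℝ[X]) = 2 := rfl
    rw [h3, h4]
    linear_combination (g + g * X) * this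
  rw [e, jacobiInt_sub h1 hβ, jacobiInt_one_sub_mul, jacobiInt_C_mul,
    show α - 1 / 2 + 1 = α + 1 / 2 by ring] at h
  rw [edgeInt]
  linarith

/-- Here the weight has no factor at 1, and the integrand is the exact derivative of (1+x)^{β+1} g,
which survives only at the endpoint 1. -/
lemma edgeInt_neg_half {β : ℝ} (hβ : -1 < β) (g : ℝ[X]) :
    edgeInt (-1 / 2) β g = 2 ^ β * g.eval 1 := by
  have hb' : 0 < β + 1 := by linarith
  have e0 : (-1 / 2 + 1 / 2 : ℝ) = 0 := by norm_num
  rw [edgeInt, e0, jacobiInt]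
  have := intervalIntegral.integral_eq_sub_of_hasDerivAt_of_le (a := -1) (b := 1) (by norm_num)
    (f := fun y : ℝ => (1 + y) ^ (β + 1) * g.eval y)
    (f' := fun x : ℝ => (1 - x) ^ (0 : ℝ) * (1 + x) ^ β *
      (C (-1 / 2 + β + 3 / 2) * g + (1 + X) * derivative g).eval x) ?_ ?_
    (intervalIntegrable_weight (by norm_num) hβ _)
  · rw [this]
    norm_num
    rw [Real.zero_rpow hb'.ne', Real.rpow_add two_pos, Real.rpow_one]
    ring
  · exact ContinuousOn.mul (ContinuousOn.rpow_const (by fun_prop) fun x _ => Or.inr hb'.le)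
      g.continuous.continuousOn
  · intro x hx
    have h2 : 0 < 1 + x := by linarith [hx.1]
    have d2 : HasDerivAt (fun y : ℝ => (1 + y) ^ (β + 1)) (1 * (β + 1) * (1 + x) ^ β) x := by
      have := ((hasDerivAt_id x).const_add 1).rpow_const (p := β + 1) (Or.inl h2.ne')
      simpa using this
    refine (d2.mul (g.hasDerivAt x)).congr_deriv ?_
    simp only [eval_add, eval_mul, eval_one, eval_X, eval_C]
    rw [Real.rpow_add h2, Real.rpow_one, Real.rpow_zero]
    ring

lemma edgeInt_one_sub_mul {α β : ℝ} (hα : -1 / 2 ≤ α) (hβ : -1 < β) (g : ℝ[X]) :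
    edgeInt α β ((1 - X) * g) = (α + 1 / 2) * jacobiInt (α + 1 / 2) β g := by
  rcases hα.eq_or_lt with rfl | h
  · rw [edgeInt_neg_half hβ]; norm_num
  · rw [edgeInt_eq h hβ, jacobiInt_one_sub_mul]; ring_nf

lemma edgeInt_add {α β : ℝ} (hα : -1 / 2 ≤ α) (hβ : -1 < β) (f g : ℝ[X]) :
    edgeInt α β (f + g) = edgeInt α β f + edgeInt α β g := by
  rcases hα.eq_or_lt with rfl | h
  · simp only [edgeInt_neg_half hβ, eval_add]; ring
  · simp only [edgeInt_eq h hβ, jacobiInt_add (by linarith : -1 < α - 1 / 2) hβ]; ring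

lemma edgeInt_C_mul (α β c : ℝ) (g : ℝ[X]) : edgeInt α β (C c * g) = c * edgeInt α β g := by
  rw [edgeInt, edgeInt, derivative_C_mul, mul_div_assoc', ← jacobiInt_C_mul]
  congr 2; ring

lemma edgeInt_sub {α β : ℝ} (hα : -1 / 2 ≤ α) (hβ : -1 < β) (f g : ℝ[X]) :
    edgeInt α β (f - g) = edgeInt α β f - edgeInt α β g := by
  have := edgeInt_C_mul α β (-1) g
  rw [sub_eq_add_neg, edgeInt_add hα hβ, show -g = C (-1) * g by simp, this]; ring

lemma raise_derivative_orthPoly (n : ℕ) (a b : ℝ) :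
    raise a b (derivative (orthPoly a b n)) = C (-(n * (n + a + b + 1))) * orthPoly a b n := by
  rw [orthPoly, jacobiPoly, derivative_C_mul, derivative_C_mul, raise_C_mul, raise_C_mul,
    raise_derivative_rodrigues]
  ring

/-- Lagrange's identity for the two Jacobi equations. -/
lemma jacobiInt_eq_edgeInt {α β : ℝ} (hα : -1 / 2 ≤ α) (hβ : -1 < β) (m n : ℕ) :
    ((n - m + 1 / 2 : ℝ) * (n + m + α + β + 3 / 2)) *
      jacobiInt (α + 1 / 2) β (orthPoly α β m * orthPoly (α + 1) β n) =
      edgeInt α β (orthPoly α β m * orthPoly (α + 1) β n) := by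
  have h1 : -1 < α + 1 / 2 := by linarith
  set q := orthPoly α β m with hq
  set r := orthPoly (α + 1) β n with hr
  -- The weight w_{α+1/2,β} is off by half a power from each family's own weight, in opposite
  -- directions. On subtraction the first-order errors combine into the full derivative (qr)', which
  -- is the derivative term of `edgeInt`.
  have hq' : raise (α + 1 / 2) β (derivative q) =
      C (-(m * (m + α + β + 1))) * q - C (1 / 2) * ((1 + X) * derivative q) := by
    rw [hq, ← raise_derivative_orthPoly]
    simp only [raise, map_add, map_one]; ring
  have hr' : raise (α + 1 / 2) β (derivative r) =
      C (-(n * (n + α + β + 2))) * r + C (1 / 2) * ((1 + X) * derivative r) := by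
    have : -((n : ℝ) * (n + α + β + 2)) = -(n * (n + (α + 1) + β + 1)) := by ring
    rw [hr, this, ← raise_derivative_orthPoly]
    simp only [raise, map_add, map_one]
    have : (C (1 / 2 : ℝ) : ℝ[X]) + C (1 / 2) = 1 := by rw [← C_add]; norm_num
    linear_combination (1 + X) * derivative (orthPoly (α + 1) β n) * (-this)
  have k1 := jacobiInt_mul_raise h1 hβ q (derivative r)
  have k2 := jacobiInt_mul_raise h1 hβ r (derivative q)
  have k3 : jacobiInt (α + 1 / 2) β ((1 + X) * derivative (q * r)) =
      jacobiInt (α + 1 / 2) β (r * ((1 + X) * derivative q)) +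
      jacobiInt (α + 1 / 2) β (q * ((1 + X) * derivative r)) := by
    rw [← jacobiInt_add h1 hβ, derivative_mul]; congr 1; ring
  rw [hr', mul_add, jacobiInt_add h1 hβ, mul_left_comm, jacobiInt_C_mul, mul_left_comm q (C _),
    jacobiInt_C_mul] at k1
  rw [hq', mul_sub, jacobiInt_sub h1 hβ, mul_left_comm, jacobiInt_C_mul, mul_left_comm r (C _),
    jacobiInt_C_mul, mul_comm r q, mul_comm (derivative r)] at k2
  rw [edgeInt, jacobiInt_add h1 hβ, jacobiInt_C_mul, k3]
  linear_combination k2 - k1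

/-! ### Bidiagonal relations and their coefficients -/

/-- The diagonal coefficient of the bidiagonal relation between the families `(a,b)`, `(a+1,b)`. -/
noncomputable def diagCoeff (a b : ℝ) (n : ℕ) : ℝ :=
  jacobiInt (a + 1) b (orthPoly a b n * orthPoly (a + 1) b n)

/-- The off-diagonal coefficient of the bidiagonal relation. -/
noncomputable def offCoeff (a b : ℝ) (n : ℕ) : ℝ :=
  -jacobiInt (a + 1) b (orthPoly a b (n + 1) * orthPoly (a + 1) b n)

/-- For k < n the coefficient on the k-th polynomial vanishes: moving 1-x from the weight onto that
polynomial gives degree at most k+1 < n+1, orthogonal to `orthPoly a b (n + 1)`. -/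
lemma orthPoly_succ_eq {a b : ℝ} (ha : -1 < a) (hb : -1 < b) (n : ℕ) :
    orthPoly a b (n + 1) = C (diagCoeff a b (n + 1)) * orthPoly (a + 1) b (n + 1) -
      C (offCoeff a b n) * orthPoly (a + 1) b n := by
  have hd : (orthPoly a b (n + 1)).natDegree < n + 2 :=
    Nat.lt_succ_of_le (natDegree_orthPoly_le a b (n + 1))
  have h := eq_sum_orthPoly (a := a + 1) (by linarith) hb hd
  rw [Finset.sum_range_succ, Finset.sum_range_succ, Finset.sum_eq_zero] at h
  · rw [diagCoeff, offCoeff]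
    conv_lhs => rw [h]
    rw [C_neg]; ring
  · intro k hk
    have hk := Finset.mem_range.1 hk
    rw [← jacobiInt_one_sub_mul, mul_comm (orthPoly a b (n + 1)), ← mul_assoc,
      jacobiInt_mul_orthPoly_eq_zero ha hb, C_0, zero_mul]
    have h1 := natDegree_orthPoly_le (a + 1) b k
    have h2 : (1 - X : ℝ[X]).natDegree ≤ 1 := by compute_degree
    exact natDegree_mul_le.trans_lt (by omega)

/-- The transpose of the previous relation: the same integrals occur as coefficients, since the
factor 1-x can be read as part of the weight. -/
lemma one_sub_mul_orthPoly {a b : ℝ} (ha : -1 < a) (hb : -1 < b) (n : ℕ) :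
    (1 - X) * orthPoly (a + 1) b n = C (diagCoeff a b n) * orthPoly a b n -
      C (offCoeff a b n) * orthPoly a b (n + 1) := by
  have hd : ((1 - X) * orthPoly (a + 1) b n).natDegree < n + 2 := by
    have h1 := natDegree_orthPoly_le (a + 1) b n
    have h2 : (1 - X : ℝ[X]).natDegree ≤ 1 := by compute_degree
    exact natDegree_mul_le.trans_lt (by omega)
  have h := eq_sum_orthPoly ha hb hd
  simp only [mul_assoc, jacobiInt_one_sub_mul] at h
  rw [Finset.sum_range_succ, Finset.sum_range_succ, Finset.sum_eq_zero] at h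
  · rw [h, diagCoeff, offCoeff, C_neg, mul_comm (orthPoly a b n) (orthPoly (a + 1) b n),
      mul_comm (orthPoly a b (n + 1)) (orthPoly (a + 1) b n)]
    ring
  · intro k hk
    have hk := Finset.mem_range.1 hk
    rw [mul_comm (orthPoly (a + 1) b n), jacobiInt_mul_orthPoly_eq_zero (by linarith) hb, C_0,
      zero_mul]
    exact (natDegree_orthPoly_le a b k).trans_lt hk

lemma ascPochhammer_eval_mul_add (z : ℝ) (n : ℕ) :
    (ascPochhammer ℝ n).eval z * (z + n) = z * (ascPochhammer ℝ n).eval (z + 1) := by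
  rw [← ascPochhammer_succ_eval, ascPochhammer_eval_succ_left]

lemma diagCoeff_eq {a b : ℝ} (ha : -1 < a) (hb : -1 < b) (n : ℕ) :
    diagCoeff a b n = conn (a + 1) b (-1) 0 n / (√(normSq a b n) * √(normSq (a + 1) b n)) := by
  have := jacobiInt_orthPoly_mul (e := a + 1) (by linarith) hb (-1) 0 n
  rw [zero_add, add_neg_cancel_right] at this
  exact this

lemma offCoeff_eq {a b : ℝ} (ha : -1 < a) (hb : -1 < b) (n : ℕ) :
    offCoeff a b n =
      -conn (a + 1) b (-1) 1 n / (√(normSq a b (n + 1)) * √(normSq (a + 1) b n)) := by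
  have := jacobiInt_orthPoly_mul (e := a + 1) (by linarith) hb (-1) 1 n
  rw [add_comm 1 n, add_neg_cancel_right] at this
  rw [offCoeff, this, neg_div]

/-- This and the next three lemmas compare one connection integral with each of the two squared
norms in its normalization. Multiplying the two comparisons gives the square of the coefficient
without any remaining Gamma factor. -/
lemma conn_zero_mul_left {a b : ℝ} (ha : -1 < a) (hb : -1 < b) (n : ℕ) :
    conn (a + 1) b (-1) 0 n * (2 * n + a + b + 2) = 2 * (n + a + 1) * normSq a b n := by
  have hn : (0 : ℝ) ≤ n := by positivity
  have g1 : Real.Gamma (a + 1 + n + 1) = (n + a + 1) * Real.Gamma (a + n + 1) := by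
    rw [show (n + a + 1 : ℝ) = a + n + 1 by ring, ← Real.Gamma_add_one (by linarith)]; ring_nf
  have g2 : Real.Gamma (a + 1 + b + 2 * n + 2) =
      (2 * n + a + b + 2) * Real.Gamma (a + b + 2 * n + 2) := by
    rw [show (2 * n + a + b + 2 : ℝ) = a + b + 2 * n + 2 by ring,
      ← Real.Gamma_add_one (by linarith)]; ring_nf
  have h3 := Real.Gamma_pos_of_pos (s := a + b + 2 * n + 2) (by linarith)
  have h4 : 0 < 2 * n + a + b + 2 := by linarith
  simp only [normSq, conn, ascPochhammer_zero, eval_one, Nat.factorial_zero, Nat.cast_one,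
    Nat.cast_zero, zero_add, add_zero, add_neg_cancel_right, g1, g2]
  rw [show a + 1 + b + 1 = a + b + 1 + 1 by ring, Real.rpow_add two_pos (a + b + 1) 1,
    Real.rpow_one]
  field_simp

lemma conn_zero_mul_right {a b : ℝ} (n : ℕ) :
    conn (a + 1) b (-1) 0 n * (2 * n + a + b + 1) = (n + a + b + 1) * normSq (a + 1) b n := by
  have h := ascPochhammer_eval_mul_add (n + a + b + 1) n
  simp only [normSq, conn, ascPochhammer_zero, eval_one, Nat.factorial_zero, Nat.cast_one,
    Nat.cast_zero, zero_add, add_zero, add_neg_cancel_right]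
  rw [show (n : ℝ) + (a + 1) + b + 1 = n + a + b + 1 + 1 by ring]
  linear_combination 2 ^ (a + 1 + b + 1) * (Real.Gamma (a + 1 + n + 1) *
    Real.Gamma (b + n + 1) / Real.Gamma (a + 1 + b + 2 * n + 2)) * (n.factorial : ℝ)⁻¹ * h

lemma conn_one_mul_right {a b : ℝ} (ha : -1 < a) (hb : -1 < b) (n : ℕ) :
    -conn (a + 1) b (-1) 1 n * (2 * n + a + b + 3) = (n + b + 1) * normSq (a + 1) b n := by
  have hn : (0 : ℝ) ≤ n := by positivity
  have g1 : Real.Gamma (b + (1 + n) + 1) = (n + b + 1) * Real.Gamma (b + n + 1) := by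
    rw [show (n + b + 1 : ℝ) = b + n + 1 by ring, ← Real.Gamma_add_one (by linarith)]; ring_nf
  have g2 : Real.Gamma (a + 1 + b + 1 + 2 * n + 2) =
      (2 * n + a + b + 3) * Real.Gamma (a + 1 + b + 2 * n + 2) := by
    rw [show (2 * n + a + b + 3 : ℝ) = a + 1 + b + 2 * n + 2 by ring,
      ← Real.Gamma_add_one (by linarith)]; ring_nf
  have h3 := Real.Gamma_pos_of_pos (s := a + 1 + b + 2 * n + 2) (by linarith)
  have h4 : 0 < 2 * n + a + b + 3 := by linarith
  simp only [normSq, conn, ascPochhammer_zero, ascPochhammer_one, eval_X, eval_one,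
    Nat.factorial_zero, Nat.factorial_one, Nat.cast_one, Nat.cast_zero, zero_add, add_zero,
    add_neg_cancel_right, g1, g2]
  rw [show 1 + (n : ℝ) + a + b + 1 = n + (a + 1) + b + 1 by ring]
  generalize Real.Gamma (a + 1 + b + 2 * n + 2) = G at *
  generalize 2 * n + a + b + 3 = t at *
  field_simp

lemma conn_one_mul_left {a b : ℝ} (n : ℕ) :
    -conn (a + 1) b (-1) 1 n * (2 * n + a + b + 2) = 2 * (n + 1) * normSq a b (n + 1) := by
  have h3 : (n.factorial : ℝ) ≠ 0 := by positivity
  have h4 : (n : ℝ) + 1 ≠ 0 := by positivity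
  have e : (n + 1 : ℕ) + a + b + 1 = n + a + b + 2 := by push_cast; ring
  simp only [normSq, conn, ascPochhammer_zero, ascPochhammer_one, eval_X, eval_one,
    Nat.factorial_zero, Nat.cast_one, Nat.cast_zero, zero_add, add_zero, add_neg_cancel_right, e, ascPochhammer_succ_eval, Nat.factorial_succ]
  push_cast
  rw [show a + 1 + b + 1 = a + b + 1 + 1 by ring, Real.rpow_add two_pos (a + b + 1) 1,
    Real.rpow_one, show 1 + (n : ℝ) + a + b + 1 = n + a + b + 2 by ring,
    show a + 1 + (n : ℝ) + 1 = a + (n + 1) + 1 by ring,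
    show b + (1 + (n : ℝ)) + 1 = b + (n + 1) + 1 by ring,
    show a + b + 1 + 1 + 2 * (n : ℝ) + 2 = a + b + 2 * (n + 1) + 2 by ring]
  generalize Real.Gamma (a + b + 2 * (n + 1) + 2) = G
  field_simp
  ring

lemma diagCoeff_sq {a b : ℝ} (ha : -1 < a) (hb : -1 < b) (n : ℕ) :
    diagCoeff a b n ^ 2 * ((2 * n + a + b + 2) * (2 * n + a + b + 1)) =
      2 * (n + a + 1) * (n + a + b + 1) := by
  have p1 := normSq_pos ha hb n
  have p2 := normSq_pos (by linarith : -1 < a + 1) hb n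
  have h1 := conn_zero_mul_left ha hb n
  have h2 := conn_zero_mul_right (a := a) (b := b) n
  rw [diagCoeff_eq ha hb, div_pow, mul_pow, Real.sq_sqrt p1.le, Real.sq_sqrt p2.le,
    div_mul_eq_mul_div, div_eq_iff (by positivity)]
  linear_combination conn (a + 1) b (-1) 0 n * (2 * n + a + b + 1) * h1 +
    2 * (n + a + 1) * normSq a b n * h2

lemma offCoeff_sq {a b : ℝ} (ha : -1 < a) (hb : -1 < b) (n : ℕ) :
    offCoeff a b n ^ 2 * ((2 * n + a + b + 2) * (2 * n + a + b + 3)) =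
      2 * (n + 1) * (n + b + 1) := by
  have p1 := normSq_pos ha hb (n + 1)
  have p2 := normSq_pos (by linarith : -1 < a + 1) hb n
  have h1 := conn_one_mul_left (a := a) (b := b) n
  have h2 := conn_one_mul_right ha hb n
  rw [offCoeff_eq ha hb, div_pow, mul_pow, Real.sq_sqrt p1.le, Real.sq_sqrt p2.le,
    div_mul_eq_mul_div, div_eq_iff (by positivity)]
  linear_combination -conn (a + 1) b (-1) 1 n * (2 * n + a + b + 3) * h1 +
    2 * (n + 1) * normSq a b (n + 1) * h2

lemma diagCoeff_pos {a b : ℝ} (ha : -1 < a) (hb : -1 < b) {n : ℕ} (hn : 1 ≤ n) :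
    0 < diagCoeff a b n := by
  have hn' : (1 : ℝ) ≤ n := by exact_mod_cast hn
  have p1 := normSq_pos ha hb n
  have p2 := normSq_pos (by linarith : -1 < a + 1) hb n
  have h1 := conn_zero_mul_left ha hb n
  rw [diagCoeff_eq ha hb]
  have : 0 < conn (a + 1) b (-1) 0 n :=
    pos_of_mul_pos_left (b := 2 * n + a + b + 2)
      (by rw [h1]; have : 0 < n + a + 1 := by linarith
          positivity) (by linarith)
  have := Real.sqrt_pos.2 p1
  have := Real.sqrt_pos.2 p2
  positivity

lemma offCoeff_pos {a b : ℝ} (ha : -1 < a) (hb : -1 < b) (n : ℕ) : 0 < offCoeff a b n := by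
  have p1 := normSq_pos ha hb (n + 1)
  have p2 := normSq_pos (by linarith : -1 < a + 1) hb n
  have h1 := conn_one_mul_left (a := a) (b := b) n
  rw [offCoeff_eq ha hb]
  have : 0 < -conn (a + 1) b (-1) 1 n :=
    pos_of_mul_pos_left (b := 2 * n + a + b + 2) (by rw [h1]; positivity) (by linarith)
  have := Real.sqrt_pos.2 p1
  have := Real.sqrt_pos.2 p2
  positivity

/-- The limit `1/√2` is approached at rate `O(1/n)`. -/
lemma abs_sub_sqrt_half_le {x c y : ℝ} (hx : 0 < x) (h : |x ^ 2 - 1 / 2| ≤ c / y) :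
    |x - √(1 / 2)| ≤ 2 * c / y := by
  have h0 : (1 / 2 : ℝ) ≤ √(1 / 2) := by
    rw [Real.le_sqrt (by norm_num) (by norm_num)]; norm_num
  have h1 : √(1 / 2 : ℝ) ^ 2 = 1 / 2 := Real.sq_sqrt (by norm_num)
  have h2 : |x ^ 2 - 1 / 2| = |x - √(1 / 2)| * (x + √(1 / 2)) := by
    rw [← abs_of_pos (by positivity : 0 < x + √(1 / 2)), ← abs_mul]
    congr 1; linear_combination h1
  rw [h2] at h
  have h3 : |x - √(1 / 2)| * (1 / 2) ≤ |x - √(1 / 2)| * (x + √(1 / 2)) :=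
    mul_le_mul_of_nonneg_left (by linarith) (abs_nonneg _)
  rw [mul_div_assoc]
  linarith

/-- The case n = 0 is left out because 2n+a+b+1 vanishes there when a = b = -1/2, and `diagCoeff_sq`
then carries no information. -/
lemma diagCoeff_asymp {a b : ℝ} (ha : -1 / 2 ≤ a) (hb : -1 / 2 ≤ b) :
    ∃ c, 0 < c ∧ ∀ n : ℕ, 1 ≤ n → |diagCoeff a b n - √(1 / 2)| ≤ c / (n + 1) := by
  refine ⟨2 * (4 * (|a| + |b| + 2) ^ 2), by positivity, fun n hn => ?_⟩
  have hn' : (1 : ℝ) ≤ n := by exact_mod_cast hn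
  apply abs_sub_sqrt_half_le (diagCoeff_pos (by linarith) (by linarith) hn)
  have h := diagCoeff_sq (by linarith : -1 < a) (by linarith : -1 < b) n
  have hn0 : (0 : ℝ) ≤ n := by linarith
  have q1 : (n : ℝ) + 1 ≤ 2 * n + a + b + 2 := by linarith
  have q2 : (n : ℝ) ≤ 2 * n + a + b + 1 := by linarith
  have hq : 0 < (2 * n + a + b + 2) * (2 * n + a + b + 1) := by
    apply mul_pos <;> linarith
  -- The quadratic terms in n cancel, so a numerator linear in n faces a quadratic denominator.
  have e : diagCoeff a b n ^ 2 - 1 / 2 = ((2 * a + 1) * n + (a + b + 1) * ((3 * a - b) / 2 + 1)) /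
      ((2 * n + a + b + 2) * (2 * n + a + b + 1)) := by
    rw [eq_div_iff hq.ne']; linear_combination h
  have ha' := abs_le.1 (le_refl |a|)
  have hb' := abs_le.1 (le_refl |b|)
  have a0 := abs_nonneg a
  have b0 := abs_nonneg b
  set K := |a| + |b| + 2
  have hK : 0 ≤ K * (K - 1) := mul_nonneg (by positivity) (by linarith)
  have t1 : |2 * a + 1| ≤ 2 * K := abs_le.2 ⟨by linarith, by linarith⟩
  have t2 : |a + b + 1| ≤ K := abs_le.2 ⟨by linarith, by linarith⟩
  have t3 : |(3 * a - b) / 2 + 1| ≤ 2 * K := abs_le.2 ⟨by linarith, by linarith⟩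
  have t : |(2 * a + 1) * n + (a + b + 1) * ((3 * a - b) / 2 + 1)| ≤ 2 * K ^ 2 * (n + 1) :=
    calc _ ≤ |2 * a + 1| * n + |a + b + 1| * |(3 * a - b) / 2 + 1| := by
          refine (abs_add_le _ _).trans ?_
          rw [abs_mul, abs_mul, abs_of_nonneg (by linarith : (0 : ℝ) ≤ n)]
      _ ≤ 2 * K * n + K * (2 * K) := by gcongr
      _ ≤ 2 * K ^ 2 * (n + 1) := by nlinarith [mul_nonneg hK hn0]
  have q : ((n : ℝ) + 1) * ((n + 1) / 2) ≤ (2 * n + a + b + 2) * (2 * n + a + b + 1) :=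
    mul_le_mul q1 (by linarith) (by linarith) (by linarith)
  rw [e, abs_div, abs_of_pos hq, div_le_div_iff₀ hq (by positivity)]
  calc _ ≤ 2 * K ^ 2 * (n + 1) * (n + 1) := by gcongr
    _ = 4 * K ^ 2 * (((n : ℝ) + 1) * ((n + 1) / 2)) := by ring
    _ ≤ _ := by gcongr

lemma offCoeff_asymp {a b : ℝ} (ha : -1 / 2 ≤ a) (hb : -1 / 2 ≤ b) :
    ∃ c, 0 < c ∧ ∀ n : ℕ, |offCoeff a b n - √(1 / 2)| ≤ c / (n + 1) := by
  refine ⟨2 * (4 * (|a| + |b| + 2) ^ 2), by positivity, fun n => ?_⟩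
  have hn' : (0 : ℝ) ≤ n := by positivity
  apply abs_sub_sqrt_half_le (offCoeff_pos (by linarith) (by linarith) n)
  have h := offCoeff_sq (by linarith : -1 < a) (by linarith : -1 < b) n
  have hq : 0 < (2 * n + a + b + 2) * (2 * n + a + b + 3) := by
    apply mul_pos <;> linarith
  have e : offCoeff a b n ^ 2 - 1 / 2 =
      (-(2 * a + 1) * n + (2 * (b + 1) - (a + b + 2) * (a + b + 3) / 2)) /
      ((2 * n + a + b + 2) * (2 * n + a + b + 3)) := by
    rw [eq_div_iff hq.ne']; linear_combination h
  have ha' := abs_le.1 (le_refl |a|)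
  have hb' := abs_le.1 (le_refl |b|)
  have a0 := abs_nonneg a
  have b0 := abs_nonneg b
  set K := |a| + |b| + 2
  have hK : 0 ≤ K * (K - 1) := mul_nonneg (by positivity) (by linarith)
  have t1 : |-(2 * a + 1)| ≤ 2 * K := abs_le.2 ⟨by linarith, by linarith⟩
  have t2 : |a + b + 2| ≤ K := abs_le.2 ⟨by linarith, by linarith⟩
  have t3 : |a + b + 3| ≤ K + 1 := abs_le.2 ⟨by linarith, by linarith⟩
  have t4 : |2 * (b + 1)| ≤ 2 * K := abs_le.2 ⟨by linarith, by linarith⟩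
  have t : |-(2 * a + 1) * n + (2 * (b + 1) - (a + b + 2) * (a + b + 3) / 2)| ≤
      4 * K ^ 2 * (n + 1) :=
    calc _ ≤ |-(2 * a + 1)| * n + (|2 * (b + 1)| + |a + b + 2| * |a + b + 3| / 2) := by
          refine (abs_add_le _ _).trans (add_le_add ?_ ((abs_sub _ _).trans ?_))
          · rw [abs_mul, abs_of_nonneg hn']
          · rw [abs_div, abs_mul (a + b + 2), abs_two]
      _ ≤ 2 * K * n + (2 * K + K * (K + 1) / 2) := by gcongr
      _ ≤ 4 * K ^ 2 * (n + 1) := by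
          nlinarith [mul_nonneg hK hn', mul_nonneg (sq_nonneg K) hn', hK]
  have q : ((n : ℝ) + 1) * (n + 1) ≤ (2 * n + a + b + 2) * (2 * n + a + b + 3) :=
    mul_le_mul (by linarith) (by linarith) (by linarith) (by linarith)
  rw [e, abs_div, abs_of_pos hq, div_le_div_iff₀ hq (by positivity)]
  calc _ ≤ 4 * K ^ 2 * (n + 1) * (n + 1) := by gcongr
    _ = 4 * K ^ 2 * (((n : ℝ) + 1) * (n + 1)) := by ring
    _ ≤ _ := by gcongr

/-! ### Uniform bounds for Gamma ratios -/

/-- Euler's limit formula for Γ(u), with the product rewritten as a quotient of Gamma values. -/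
lemma tendsto_Gamma_ratio {u : ℝ} (hu : 0 < u) :
    Tendsto (fun n : ℕ => Real.Gamma ((n + 1 : ℕ) + u) /
      ((n + 1).factorial * ((n + 1 : ℕ) + 1 : ℝ) ^ (u - 1))) atTop (𝓝 1) := by
  have hG := (Real.Gamma_pos_of_pos hu).ne'
  have h1 : Tendsto (fun n : ℕ => Real.Gamma u / Real.GammaSeq u n) atTop (𝓝 1) := by
    have := (tendsto_const_nhds (x := Real.Gamma u)).div (Real.GammaSeq_tendsto_Gamma u) hG
    rwa [div_self hG] at this
  have h2 : Tendsto (fun n : ℕ => (n : ℝ) / (n + 1)) atTop (𝓝 1) := tendsto_natCast_div_add_atTop 1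
  have h3 : Tendsto (fun n : ℕ => ((n : ℝ) / (n + 2)) ^ (u - 1)) atTop (𝓝 1) := by
    have := (tendsto_natCast_div_add_atTop (2 : ℝ)).rpow_const (p := u - 1) (Or.inl one_ne_zero)
    rwa [Real.one_rpow] at this
  have h := (h1.mul h2).mul h3
  rw [mul_one, mul_one] at h
  refine h.congr' ?_
  filter_upwards [eventually_gt_atTop 0] with n hn
  have hn' : (0 : ℝ) < n := by exact_mod_cast hn
  have hprod : Real.Gamma ((n + 1 : ℕ) + u) = (∏ j ∈ Finset.range (n + 1), (u + j)) *
      Real.Gamma u := by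
    have : ∀ m : ℕ, Real.Gamma (m + u) = (∏ j ∈ Finset.range m, (u + j)) * Real.Gamma u := by
      intro m
      induction m with
      | zero => simp
      | succ m ih =>
        rw [Finset.prod_range_succ, Nat.cast_succ, show (m : ℝ) + 1 + u = u + m + 1 by ring,
          Real.Gamma_add_one (by positivity), add_comm u m, ih]
        ring
    exact this (n + 1)
  have hpos : 0 < ∏ j ∈ Finset.range (n + 1), (u + j) :=
    Finset.prod_pos fun j _ => by positivity
  have hf : (0 : ℝ) < n.factorial := by positivity
  have e2 : (n : ℝ) ^ u = n ^ (u - 1) * n := by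
    rw [← Real.rpow_add_one hn'.ne']; ring_nf
  have q1 : (0 : ℝ) < n ^ (u - 1) := by positivity
  rw [hprod, Real.GammaSeq, Real.div_rpow hn'.le (by positivity), e2, Nat.factorial_succ]
  push_cast
  rw [show (n : ℝ) + 1 + 1 = n + 2 by ring]
  have q2 : (0 : ℝ) < (n + 2 : ℝ) ^ (u - 1) := by positivity
  generalize (n + 2 : ℝ) ^ (u - 1) = y at *
  generalize (n : ℝ) ^ (u - 1) = x at *
  generalize ∏ j ∈ Finset.range (n + 1), (u + (j : ℝ)) = z at *
  field_simp

/-- The ratio and its inverse both converge, hence are bounded over all n; the base n+1 keeps n = 0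
harmless. -/
lemma exists_Gamma_bounds {u : ℝ} (hu : 0 < u) :
    ∃ K : ℝ, 0 < K ∧ ∀ n : ℕ,
      Real.Gamma (n + u) ≤ K * (n.factorial * (n + 1 : ℝ) ^ (u - 1)) ∧
      n.factorial * (n + 1 : ℝ) ^ (u - 1) ≤ K * Real.Gamma (n + u) := by
  set g : ℕ → ℝ := fun n => Real.Gamma (n + u) / (n.factorial * (n + 1 : ℝ) ^ (u - 1)) with hg
  have hgt : Tendsto g atTop (𝓝 1) := (tendsto_add_atTop_iff_nat 1).1 (tendsto_Gamma_ratio hu)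
  obtain ⟨K1, h1⟩ := hgt.bddAbove_range
  have hinv : Tendsto (fun n => (g n)⁻¹) atTop (𝓝 1) := by simpa using hgt.inv₀ one_ne_zero
  obtain ⟨K2, h2⟩ := hinv.bddAbove_range
  have hK : 0 < max 1 (max K1 K2) := lt_of_lt_of_le one_pos (le_max_left _ _)
  refine ⟨max 1 (max K1 K2), hK, fun n => ?_⟩
  have b1 : g n ≤ max 1 (max K1 K2) :=
    (h1 ⟨n, rfl⟩).trans ((le_max_left _ _).trans (le_max_right _ _))
  have b2 : (g n)⁻¹ ≤ max 1 (max K1 K2) :=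
    (h2 ⟨n, rfl⟩).trans ((le_max_right _ _).trans (le_max_right _ _))
  have p1 : (0 : ℝ) < n.factorial * (n + 1 : ℝ) ^ (u - 1) := by positivity
  have p2 : 0 < Real.Gamma (n + u) := Real.Gamma_pos_of_pos (by positivity)
  rw [hg] at b1 b2
  simp only [inv_div] at b1 b2
  exact ⟨(div_le_iff₀ p1).1 b1, (div_le_iff₀ p2).1 b2⟩

lemma exists_Gamma_div_le {u v : ℝ} (hu : 0 < u) (hv : 0 < v) :
    ∃ K : ℝ, 0 < K ∧ ∀ n : ℕ,
      Real.Gamma (n + u) / Real.Gamma (n + v) ≤ K * (n + 1 : ℝ) ^ (u - v) := by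
  obtain ⟨K1, k1, h1⟩ := exists_Gamma_bounds hu
  obtain ⟨K2, k2, h2⟩ := exists_Gamma_bounds hv
  refine ⟨K1 * K2, by positivity, fun n => ?_⟩
  have p2 : 0 < Real.Gamma (n + v) := Real.Gamma_pos_of_pos (by positivity)
  rw [div_le_iff₀ p2]
  have e : (n + 1 : ℝ) ^ (u - 1) = (n + 1 : ℝ) ^ (u - v) * (n + 1 : ℝ) ^ (v - 1) := by
    rw [← Real.rpow_add (by positivity)]; ring_nf
  calc _ ≤ K1 * (n.factorial * (n + 1 : ℝ) ^ (u - 1)) := (h1 n).1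
    _ = K1 * (n + 1 : ℝ) ^ (u - v) * (n.factorial * (n + 1 : ℝ) ^ (v - 1)) := by rw [e]; ring
    _ ≤ K1 * (n + 1 : ℝ) ^ (u - v) * (K2 * Real.Gamma (n + v)) :=
        mul_le_mul_of_nonneg_left (h2 n).2 (by positivity)
    _ = _ := by ring

lemma exists_Gamma_div_factorial_le {u : ℝ} (hu : 0 < u) :
    ∃ K : ℝ, 0 < K ∧ ∀ n : ℕ,
      Real.Gamma (n + u) / n.factorial ≤ K * (n + 1 : ℝ) ^ (u - 1) := by
  obtain ⟨K, k, h⟩ := exists_Gamma_div_le hu one_pos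
  refine ⟨K, k, fun n => ?_⟩
  rw [← Real.Gamma_nat_eq_factorial]
  exact h n

lemma rpow_le_rpow_abs {r K : ℝ} (h1 : K⁻¹ ≤ r) (h2 : r ≤ K) (hK : 1 ≤ K) (g : ℝ) :
    r ^ g ≤ K ^ |g| := by
  have hK0 : 0 < K := by linarith
  have hr : 0 < r := lt_of_lt_of_le (by positivity) h1
  rcases le_total 0 g with hg | hg
  · rw [abs_of_nonneg hg]
    exact Real.rpow_le_rpow hr.le h2 hg
  · rw [abs_of_nonpos hg, Real.rpow_neg hK0.le, ← Real.inv_rpow hK0.le]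
    exact Real.rpow_le_rpow_of_nonpos (by positivity) h1 hg

lemma ascPochhammer_eval_eq_Gamma {z : ℝ} (hz : 0 < z) (n : ℕ) :
    (ascPochhammer ℝ n).eval z = Real.Gamma (n + z) / Real.Gamma z := by
  rw [add_comm, Gamma_add_nat_eq hz, mul_div_cancel_right₀ _ (Real.Gamma_pos_of_pos hz).ne']

/-! ### Size of the connection coefficients -/

lemma exists_conn_le {e b s : ℝ} (he : -1 < e) (hb : -1 < b) (hs : 0 < s)
    (hsum : 0 < e + s + b + 1) :
    ∃ K : ℝ, 0 < K ∧ ∀ j k : ℕ, 0 ≤ conn e b s j k ∧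
      conn e b s j k ≤ K * ((j + 1 : ℝ) ^ (s - 1) * ((k + 1 : ℝ) / (j + k + 1)) ^ e *
        (j + k + 1 : ℝ)⁻¹) := by
  obtain ⟨K1, k1, h1⟩ := exists_Gamma_div_factorial_le hs
  obtain ⟨K2, k2, h2⟩ := exists_Gamma_div_factorial_le (by linarith : 0 < e + 1)
  obtain ⟨K3, k3, h3⟩ := exists_Gamma_div_le (by linarith : 0 < b + 1) hsum
  obtain ⟨K4, k4, h4⟩ := exists_Gamma_div_le hsum (by linarith : 0 < e + b + 2)
  have gs := Real.Gamma_pos_of_pos hs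
  refine ⟨2 ^ (e + b + 1) * (Real.Gamma s)⁻¹ * K1 * K2 * K3 * (K4 * 2 ^ |s - 1|),
    by positivity, fun j k => ?_⟩
  -- Each quotient of Gammas depends on a single integer: j, k, j+k or j+2k. As j+2k+1 lies between
  -- j+k+1 and its double, the last is absorbed into a power of j+k+1.
  have eq : conn e b s j k = 2 ^ (e + b + 1) * (Real.Gamma s)⁻¹ *
      (Real.Gamma (j + s) / j.factorial) * (Real.Gamma (k + (e + 1)) / k.factorial) *
      (Real.Gamma ((j + k : ℕ) + (b + 1)) / Real.Gamma ((j + k : ℕ) + (e + s + b + 1))) *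
      (Real.Gamma ((j + k + k : ℕ) + (e + s + b + 1)) /
        Real.Gamma ((j + k + k : ℕ) + (e + b + 2))) := by
    rw [conn, ascPochhammer_eval_eq_Gamma hs,
      ascPochhammer_eval_eq_Gamma (by linarith [(Nat.cast_nonneg j : (0 : ℝ) ≤ j),
        (Nat.cast_nonneg k : (0 : ℝ) ≤ k)] : (0 : ℝ) < j + k + (e + s) + b + 1)]
    push_cast
    rw [show (k : ℝ) + (j + k + (e + s) + b + 1) = j + k + k + (e + s + b + 1) by ring,
      show (j : ℝ) + k + (e + s) + b + 1 = j + k + (e + s + b + 1) by ring,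
      show e + (k : ℝ) + 1 = k + (e + 1) by ring,
      show b + ((j : ℝ) + k) + 1 = j + k + (b + 1) by ring,
      show e + b + j + 2 * (k : ℝ) + 2 = j + k + k + (e + b + 2) by ring]
    ring
  have p (n : ℕ) {u : ℝ} (hu : 0 < u) : 0 < Real.Gamma (n + u) :=
    Real.Gamma_pos_of_pos (by positivity)
  have p1 := p j hs
  have p2 := p k (by linarith : 0 < e + 1)
  have p3 := p (j + k) (by linarith : 0 < b + 1)
  have p4 := p (j + k) hsum
  have p5 := p (j + k + k) hsum
  have p6 := p (j + k + k) (by linarith : 0 < e + b + 2)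
  have h4' : Real.Gamma ((j + k + k : ℕ) + (e + s + b + 1)) /
      Real.Gamma ((j + k + k : ℕ) + (e + b + 2)) ≤
      K4 * 2 ^ |s - 1| * (j + k + 1 : ℝ) ^ (s - 1) := by
    refine (h4 (j + k + k)).trans ?_
    rw [mul_assoc, show e + s + b + 1 - (e + b + 2) = s - 1 by ring]
    gcongr
    have : (((j + k + k : ℕ) : ℝ) + 1) =
        ((j + k + k + 1 : ℝ) / (j + k + 1)) * (j + k + 1) := by
      push_cast; field_simp
    rw [this, Real.mul_rpow (by positivity) (by positivity)]
    gcongr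
    have hk : (0 : ℝ) ≤ k := by positivity
    have hj : (0 : ℝ) ≤ j := by positivity
    refine rpow_le_rpow_abs ?_ ?_ one_le_two _
    · rw [le_div_iff₀ (by positivity)]; linarith
    · rw [div_le_iff₀ (by positivity)]; linarith
  have h3' := h3 (j + k)
  have h1' := h1 j
  have h2' := h2 k
  rw [eq]
  refine ⟨by positivity, ?_⟩
  calc _ ≤ 2 ^ (e + b + 1) * (Real.Gamma s)⁻¹ * (K1 * (j + 1 : ℝ) ^ (s - 1)) *
        (K2 * (k + 1 : ℝ) ^ (e + 1 - 1)) *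
        (K3 * ((j + k : ℕ) + 1 : ℝ) ^ (b + 1 - (e + s + b + 1))) *
        (K4 * 2 ^ |s - 1| * (j + k + 1 : ℝ) ^ (s - 1)) := by gcongr
    _ = _ := by
        rw [Real.div_rpow (by positivity) (by positivity)]
        have e1 : ((j + k : ℕ) + 1 : ℝ) ^ (b + 1 - (e + s + b + 1)) * (j + k + 1 : ℝ) ^ (s - 1) =
            ((j + k + 1 : ℝ) ^ e)⁻¹ * (j + k + 1 : ℝ)⁻¹ := by
          push_cast
          rw [← Real.rpow_add (by positivity), ← Real.rpow_neg (by positivity),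
            ← Real.rpow_neg_one (j + k + 1 : ℝ), ← Real.rpow_add (by positivity)]
          ring_nf
        rw [show e + 1 - 1 = e by ring]
        linear_combination 2 ^ (e + b + 1) * (Real.Gamma s)⁻¹ * (K1 * (j + 1 : ℝ) ^ (s - 1)) *
          (K2 * (k + 1 : ℝ) ^ e) * K3 * (K4 * 2 ^ |s - 1|) * e1

lemma exists_inv_normSq_le {a b : ℝ} (ha : -1 < a) (hb : -1 < b) (hab : -3 / 2 ≤ a + b) :
    ∃ K : ℝ, 0 < K ∧ ∀ n : ℕ, (normSq a b n)⁻¹ ≤ K * (n + 1) := by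
  obtain ⟨K1, k1, h1⟩ := exists_Gamma_div_le one_pos (by linarith : 0 < a + 1)
  obtain ⟨K2, k2, h2⟩ := exists_Gamma_div_le (by linarith : 0 < a + b + 2)
    (by linarith : 0 < b + 1)
  refine ⟨4 * (2 ^ (a + b + 1))⁻¹ * K1 * K2, by positivity, fun n => ?_⟩
  have hn : (0 : ℝ) ≤ n := by positivity
  -- At n = 0 the argument n+a+b+1 may be nonpositive, so the Gamma quotient is taken one unit
  -- higher. The cost is the ratio (2n+a+b+1)/(n+a+b+1), at most 4 for n ≥ 1 since a+b ≥ -3/2.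
  have hp : (ascPochhammer ℝ n).eval (n + a + b + 2) ≤
      4 * (ascPochhammer ℝ n).eval (n + a + b + 1) := by
    rcases Nat.eq_zero_or_pos n with rfl | h
    · simp
    · have h' : (1 : ℝ) ≤ n := by exact_mod_cast h
      have h := ascPochhammer_eval_mul_add (n + a + b + 1) n
      have q := ascPochhammer_eval_pos (a := a) (b := b) (by linarith) n
      rw [show (n : ℝ) + a + b + 1 + 1 = n + a + b + 2 by ring] at h
      have hz : 0 < n + a + b + 1 := by linarith
      refine le_of_mul_le_mul_left ?_ hz
      rw [← h]
      nlinarith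
  have p (n : ℕ) {u : ℝ} (hu : 0 < u) : 0 < Real.Gamma (n + u) :=
    Real.Gamma_pos_of_pos (by positivity)
  have p1 := p n (by linarith : 0 < a + 1)
  have p2 := p n (by linarith : 0 < b + 1)
  have p3 := p n (by linarith : 0 < a + b + 2)
  have p4 : 0 < Real.Gamma (n + (n + a + b + 2)) := Real.Gamma_pos_of_pos (by linarith)
  have hA := ascPochhammer_eval_eq_Gamma (by linarith : (0 : ℝ) < n + a + b + 2) n
  rw [show Real.Gamma ((n : ℝ) + a + b + 2) = Real.Gamma (n + (a + b + 2)) by ring_nf] at hA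
  have lower : 2 ^ (a + b + 1) / 4 * (Real.Gamma (n + (a + 1)) * Real.Gamma (n + (b + 1)) /
      (n.factorial * Real.Gamma (n + (a + b + 2)))) ≤ normSq a b n := by
    have e1 : normSq a b n = 2 ^ (a + b + 1) * ((ascPochhammer ℝ n).eval (n + a + b + 1)) *
        (Real.Gamma (n + (a + 1)) * Real.Gamma (n + (b + 1)) /
          (n.factorial * Real.Gamma (n + (n + a + b + 2)))) := by
      simp only [normSq, conn, ascPochhammer_zero, eval_one, Nat.factorial_zero, Nat.cast_one,
        Nat.cast_zero, zero_add, add_zero]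
      rw [show a + (n : ℝ) + 1 = n + (a + 1) by ring, show b + (n : ℝ) + 1 = n + (b + 1) by ring,
        show a + b + 2 * (n : ℝ) + 2 = n + (n + a + b + 2) by ring]
      field_simp
    have e2 : 2 ^ (a + b + 1) / 4 * (Real.Gamma (n + (a + 1)) * Real.Gamma (n + (b + 1)) /
        (n.factorial * Real.Gamma (n + (a + b + 2)))) =
        2 ^ (a + b + 1) * ((ascPochhammer ℝ n).eval (n + a + b + 2) / 4) *
        (Real.Gamma (n + (a + 1)) * Real.Gamma (n + (b + 1)) /
          (n.factorial * Real.Gamma (n + (n + a + b + 2)))) := by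
      rw [hA]; field_simp
    rw [e1, e2]
    gcongr
    linarith
  refine (inv_anti₀ (by positivity) lower).trans ?_
  have e3 : (2 ^ (a + b + 1) / 4 * (Real.Gamma (n + (a + 1)) * Real.Gamma (n + (b + 1)) /
      (n.factorial * Real.Gamma (n + (a + b + 2)))))⁻¹ = 4 * (2 ^ (a + b + 1))⁻¹ *
      (Real.Gamma (n + 1) / Real.Gamma (n + (a + 1))) *
      (Real.Gamma (n + (a + b + 2)) / Real.Gamma (n + (b + 1))) := by
    rw [Real.Gamma_nat_eq_factorial]; field_simp
  rw [e3]
  calc _ ≤ 4 * (2 ^ (a + b + 1))⁻¹ * (K1 * (n + 1 : ℝ) ^ (1 - (a + 1))) *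
        (K2 * (n + 1 : ℝ) ^ (a + b + 2 - (b + 1))) := by
        gcongr
        · exact h1 n
        · exact h2 n
    _ = _ := by
        have : (n + 1 : ℝ) ^ (1 - (a + 1)) * (n + 1 : ℝ) ^ (a + b + 2 - (b + 1)) = n + 1 := by
          rw [← Real.rpow_add (by positivity)]
          ring_nf
          rw [Real.rpow_one]
        linear_combination 4 * (2 ^ (a + b + 1))⁻¹ * K1 * K2 * this

/-- Normalization multiplies the bound on `conn` by the square roots of k+1 and m+1. This cancels
half of the factor 1/(m+1) and raises the exponent e to e+1/2. -/
lemma exists_abs_coeff_le {e b s : ℝ} (he : -1 < e) (hb : -1 < b) (heb : -3 / 2 ≤ e + b)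
    (hs : 0 < s) (hsum : 0 < e + s + b + 1) :
    ∃ K : ℝ, 0 < K ∧ ∀ m k : ℕ, k ≤ m →
      |jacobiInt e b (orthPoly (e + s) b m * orthPoly e b k)| ≤
        K * ((m - k + 1 : ℝ) ^ (s - 1) * ((k + 1 : ℝ) / (m + 1)) ^ (e + 1 / 2)) := by
  obtain ⟨K0, k0, h0⟩ := exists_conn_le he hb hs hsum
  obtain ⟨K1, k1, h1⟩ := exists_inv_normSq_le he hb heb
  obtain ⟨K2, k2, h2⟩ := exists_inv_normSq_le (by linarith : -1 < e + s) hb (by linarith)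
  refine ⟨K0 * √K1 * √K2, by positivity, fun m k hkm => ?_⟩
  obtain ⟨j, rfl⟩ := Nat.exists_eq_add_of_le' hkm
  obtain ⟨hpos, hle⟩ := h0 j k
  have p1 := normSq_pos he hb k
  have p2 := normSq_pos (by linarith : -1 < e + s) hb (j + k)
  rw [jacobiInt_orthPoly_mul he hb, abs_of_nonneg (by positivity), div_eq_mul_inv, mul_inv,
    ← Real.sqrt_inv, ← Real.sqrt_inv]
  have s1 : √(normSq e b k)⁻¹ ≤ √K1 * √(k + 1 : ℝ) := by
    rw [← Real.sqrt_mul k1.le]; exact Real.sqrt_le_sqrt (h1 k)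
  have s2 : √(normSq (e + s) b (j + k))⁻¹ ≤ √K2 * √(j + k + 1 : ℝ) := by
    rw [← Real.sqrt_mul k2.le]
    refine Real.sqrt_le_sqrt ((h2 (j + k)).trans (le_of_eq ?_))
    push_cast; ring
  have r0 : (0 : ℝ) < (k + 1 : ℝ) / (j + k + 1) := by positivity
  have e1 : ((k + 1 : ℝ) / (j + k + 1)) ^ (e + 1 / 2) = ((k + 1 : ℝ) / (j + k + 1)) ^ e *
      (√(k + 1 : ℝ) * √(j + k + 1 : ℝ) * (j + k + 1 : ℝ)⁻¹) := by
    rw [Real.rpow_add r0, ← Real.sqrt_eq_rpow, Real.sqrt_div (by positivity)]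
    congr 1
    have := Real.mul_self_sqrt (by positivity : (0 : ℝ) ≤ j + k + 1)
    have q : 0 < √(j + k + 1 : ℝ) := Real.sqrt_pos.2 (by positivity)
    field_simp
    linarith
  calc _ ≤ K0 * ((j + 1 : ℝ) ^ (s - 1) * ((k + 1 : ℝ) / (j + k + 1)) ^ e *
        (j + k + 1 : ℝ)⁻¹) * ((√K2 * √(j + k + 1 : ℝ)) * (√K1 * √(k + 1 : ℝ))) := by gcongr
    _ = _ := by
      push_cast
      rw [e1, show (j : ℝ) + k - k + 1 = j + 1 by ring]
      ring

/-! ### Discrete Beta sums and integrals of products -/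

/-- Bernoulli's inequality for exponents in (0,1] bounds each term by a telescoping difference of
M^p / p. -/
lemma sum_rpow_le {p : ℝ} (hp : 0 < p) (hp1 : p ≤ 1) (M : ℕ) :
    ∑ k ∈ Finset.range M, (k + 1 : ℝ) ^ (p - 1) ≤ (M : ℝ) ^ p / p := by
  induction M with
  | zero => simp [Real.zero_rpow hp.ne']
  | succ M ih =>
    rw [Finset.sum_range_succ]
    have hM : (0 : ℝ) < M + 1 := by positivity
    have hb := rpow_one_add_le_one_add_mul_self (s := -(1 / (M + 1 : ℝ)))
      (by rw [neg_le_neg_iff, div_le_one hM]; linarith [(Nat.cast_nonneg M : (0 : ℝ) ≤ M)])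
      hp.le hp1
    have e1 : 1 + -(1 / (M + 1 : ℝ)) = M / (M + 1) := by field_simp; ring
    rw [e1, Real.div_rpow (by positivity) hM.le, div_le_iff₀ (by positivity)] at hb
    have e2 : (M + 1 : ℝ) ^ p = (M + 1 : ℝ) ^ (p - 1) * (M + 1) := by
      rw [← Real.rpow_add_one hM.ne']; ring_nf
    have e3 : (1 + p * -(1 / (M + 1 : ℝ))) * (M + 1 : ℝ) ^ p =
        (M + 1 : ℝ) ^ p - p * (M + 1 : ℝ) ^ (p - 1) := by
      rw [e2]; field_simp; ring
    rw [e3] at hb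
    have h2 : (M + 1 : ℝ) ^ (p - 1) ≤ ((M + 1 : ℝ) ^ p - (M : ℝ) ^ p) / p := by
      rw [le_div_iff₀ hp]; linarith
    push_cast
    have : ((M + 1 : ℝ) ^ p - (M : ℝ) ^ p) / p = (M + 1 : ℝ) ^ p / p - (M : ℝ) ^ p / p :=
      sub_div _ _ _
    linarith

/-- A discrete Beta integral bound. -/
lemma exists_sum_beta_le {g : ℝ} (hg : -1 < g) :
    ∃ K : ℝ, 0 < K ∧ ∀ N : ℕ, ∑ k ∈ Finset.range (N + 1),
      ((k + 1 : ℝ) / (N + 1)) ^ g * (N - k + 1 : ℝ) ^ (-(1 / 2) : ℝ) ≤ K * √(N + 1 : ℝ) := by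
  -- The ratios (k+1)/(N+1) are at most 1, so g may be lowered to an exponent p-1 in (-1,0], where
  -- `sum_rpow_le` applies.
  obtain ⟨p, hp, hp1, hpg⟩ : ∃ p : ℝ, 0 < p ∧ p ≤ 1 ∧ p - 1 ≤ g :=
    ⟨min (g + 1) 1, lt_min (by linarith) one_pos, min_le_right _ _, by
      linarith [min_le_left (g + 1) 1]⟩
  refine ⟨4 + 2 / p, by positivity, fun N => ?_⟩
  have hN : (0 : ℝ) < N + 1 := by positivity
  have half2 : ((1 : ℝ) / 2) ^ (p - 1) ≤ 2 := by
    have := rpow_le_rpow_abs (r := 1 / 2) (K := 2) (by norm_num) (by norm_num) one_le_two (p - 1)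
    refine this.trans ?_
    conv_rhs => rw [← Real.rpow_one 2]
    refine Real.rpow_le_rpow_of_exponent_le one_le_two ?_
    rw [abs_le]; constructor <;> linarith
  have term : ∀ k ∈ Finset.range (N + 1),
      ((k + 1 : ℝ) / (N + 1)) ^ g * (N - k + 1 : ℝ) ^ (-(1 / 2) : ℝ) ≤
      2 * (N - k + 1 : ℝ) ^ ((1 / 2 : ℝ) - 1) +
      2 * (N + 1 : ℝ) ^ (-(1 / 2) - (p - 1) : ℝ) * (k + 1 : ℝ) ^ (p - 1) := by
    intro k hk
    have hk' : (k : ℝ) ≤ N := by exact_mod_cast Nat.lt_succ_iff.1 (Finset.mem_range.1 hk)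
    have hk0 : (0 : ℝ) ≤ k := by positivity
    have hy : (0 : ℝ) < N - k + 1 := by linarith
    have hr : (0 : ℝ) < (k + 1 : ℝ) / (N + 1) := by positivity
    have h1 : ((k + 1 : ℝ) / (N + 1)) ^ g ≤ ((k + 1 : ℝ) / (N + 1)) ^ (p - 1) :=
      Real.rpow_le_rpow_of_exponent_ge hr ((div_le_one hN).2 (by linarith)) hpg
    rw [show (1 / 2 : ℝ) - 1 = -(1 / 2) by norm_num]
    refine (mul_le_mul_of_nonneg_right h1 (by positivity)).trans ?_
    -- Only one of the two factors can be singular: the first is bounded when k+1 is at least half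
    -- of N+1, the second is of order (N+1)^{-1/2} otherwise.
    rcases le_total ((1 : ℝ) / 2) ((k + 1 : ℝ) / (N + 1)) with h | h
    · have : ((k + 1 : ℝ) / (N + 1)) ^ (p - 1) ≤ 2 :=
        (Real.rpow_le_rpow_of_nonpos (by norm_num) h (by linarith)).trans half2
      exact (mul_le_mul_of_nonneg_right this (by positivity)).trans
        (le_add_of_nonneg_right (by positivity))
    · rw [div_le_iff₀ hN] at h
      have h2 : (N - k + 1 : ℝ) ^ (-(1 / 2) : ℝ) ≤ 2 * (N + 1 : ℝ) ^ (-(1 / 2) : ℝ) := by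
        have h3 : (N - k + 1 : ℝ) ^ (-(1 / 2) : ℝ) ≤ (1 / 2 * (N + 1) : ℝ) ^ (-(1 / 2) : ℝ) :=
          Real.rpow_le_rpow_of_nonpos (by positivity) (by linarith) (by norm_num)
        refine h3.trans ?_
        rw [Real.mul_rpow (by norm_num) hN.le]
        gcongr
        have := rpow_le_rpow_abs (r := 1 / 2) (K := 2) (by norm_num) (by norm_num) one_le_two
          (-(1 / 2))
        refine this.trans ?_
        conv_rhs => rw [← Real.rpow_one 2]
        refine Real.rpow_le_rpow_of_exponent_le one_le_two ?_
        rw [abs_le]; constructor <;> norm_num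
      refine le_trans ?_ (le_add_of_nonneg_left (by positivity))
      calc _ ≤ ((k + 1 : ℝ) / (N + 1)) ^ (p - 1) * (2 * (N + 1 : ℝ) ^ (-(1 / 2) : ℝ)) := by gcongr
        _ = _ := by
          rw [Real.div_rpow (by positivity) hN.le, Real.rpow_sub hN (-(1 / 2)) (p - 1)]
          ring
  refine (Finset.sum_le_sum term).trans ?_
  rw [Finset.sum_add_distrib, ← Finset.mul_sum, ← Finset.mul_sum]
  have S1 : ∑ k ∈ Finset.range (N + 1), (N - k + 1 : ℝ) ^ ((1 / 2 : ℝ) - 1) ≤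
      2 * √(N + 1 : ℝ) := by
    rw [← Finset.sum_range_reflect]
    have := sum_rpow_le (p := 1 / 2) (by norm_num) (by norm_num) (N + 1)
    rw [Real.sqrt_eq_rpow]
    calc _ = ∑ k ∈ Finset.range (N + 1), (k + 1 : ℝ) ^ ((1 / 2 : ℝ) - 1) := by
          refine Finset.sum_congr rfl fun k hk => ?_
          have hk' := Nat.lt_succ_iff.1 (Finset.mem_range.1 hk)
          rw [Nat.add_sub_cancel, Nat.cast_sub hk']
          congr 1; ring
      _ ≤ _ := this
      _ = _ := by push_cast; ring
  have S2 := sum_rpow_le hp hp1 (N + 1)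
  push_cast at S2
  have e1 : (N + 1 : ℝ) ^ (-(1 / 2) - (p - 1) : ℝ) * ((N + 1 : ℝ) ^ p / p) = √(N + 1 : ℝ) / p := by
    rw [mul_div_assoc', ← Real.rpow_add hN, Real.sqrt_eq_rpow]
    congr 2; ring
  calc _ ≤ 2 * (2 * √(N + 1 : ℝ)) +
        2 * (N + 1 : ℝ) ^ (-(1 / 2) - (p - 1) : ℝ) * ((N + 1 : ℝ) ^ p / p) := by gcongr
    _ = _ := by rw [mul_assoc 2 ((N + 1 : ℝ) ^ _), e1]; ring

/-- The degrees `m` and `n` are of the same order of magnitude. -/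
def Comparable (m n : ℕ) : Prop := m + 1 ≤ 4 * (n + 1) ∧ n + 1 ≤ 4 * (m + 1)

lemma Comparable.symm {m n : ℕ} (h : Comparable m n) : Comparable n m := ⟨h.2, h.1⟩

lemma Comparable.left {m n : ℕ} (h : Comparable m n) : (m + 1 : ℝ) ≤ 4 * (n + 1) := by
  exact_mod_cast h.1

lemma Comparable.abs_sub_add_one_le {m n : ℕ} (h : Comparable m n) :
    |(m : ℝ) - n| + 1 ≤ 4 * (m + 1) := by
  have h2 := h.symm.left
  have hm : (0 : ℝ) ≤ m := by positivity
  have hn : (0 : ℝ) ≤ n := by positivity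
  have : |(m : ℝ) - n| ≤ 4 * (m + 1) - 1 := abs_le.2 ⟨by linarith, by linarith⟩
  linarith

lemma exists_abs_jacobiInt_le {e b s t : ℝ} (he : -1 < e) (hb : -1 < b) (heb : -3 / 2 ≤ e + b)
    (hs : 0 < s) (ht : 0 < t) (hs' : 0 < e + s + b + 1) (ht' : 0 < e + t + b + 1) :
    ∃ K : ℝ, 0 < K ∧ ∀ m n : ℕ, Comparable m n →
      |jacobiInt e b (orthPoly (e + s) b m * orthPoly (e + t) b n)| ≤
        K * ∑ k ∈ Finset.range (min m n + 1), ((k + 1 : ℝ) / ((min m n : ℕ) + 1)) ^ (2 * e + 1) *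
          ((m - k + 1 : ℝ) ^ (s - 1) * (n - k + 1 : ℝ) ^ (t - 1)) := by
  obtain ⟨K1, k1, h1⟩ := exists_abs_coeff_le he hb heb hs hs'
  obtain ⟨K2, k2, h2⟩ := exists_abs_coeff_le he hb heb ht ht'
  refine ⟨K1 * K2 * 4 ^ |e + 1 / 2|, by positivity, fun m n hmn => ?_⟩
  have hexp : jacobiInt e b (orthPoly (e + s) b m * orthPoly (e + t) b n) =
      ∑ k ∈ Finset.range (min m n + 1), jacobiInt e b (orthPoly (e + s) b m * orthPoly e b k) *
        jacobiInt e b (orthPoly (e + t) b n * orthPoly e b k) := by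
    rcases le_total m n with h | h
    · rw [min_eq_left h]
      exact jacobiInt_mul_eq_sum he hb _ (Nat.lt_succ_of_le (natDegree_orthPoly_le _ _ _))
    · rw [min_eq_right h, mul_comm, jacobiInt_mul_eq_sum he hb _
        (Nat.lt_succ_of_le (natDegree_orthPoly_le _ _ _))]
      exact Finset.sum_congr rfl fun k _ => mul_comm _ _
  rw [hexp, Finset.mul_sum]
  refine (Finset.abs_sum_le_sum_abs _ _).trans (Finset.sum_le_sum fun k hk => ?_)
  have hk' := Nat.lt_succ_iff.1 (Finset.mem_range.1 hk)
  have hkm : k ≤ m := hk'.trans (min_le_left _ _)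
  have hkn : k ≤ n := hk'.trans (min_le_right _ _)
  have c1 : (0 : ℝ) < m - k + 1 := by
    have : (k : ℝ) ≤ m := by exact_mod_cast hkm
    linarith
  have c2 : (0 : ℝ) < n - k + 1 := by
    have : (k : ℝ) ≤ n := by exact_mod_cast hkn
    linarith
  -- Comparability allows one denominator to replace the other at the cost of 4^{|e+1/2|}, so the
  -- two powers merge into one of exponent 2e+1.
  have ratio : ∀ m n : ℕ, Comparable m n →
      ((k + 1 : ℝ) / (m + 1)) ^ (e + 1 / 2) * ((k + 1 : ℝ) / (n + 1)) ^ (e + 1 / 2) ≤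
      4 ^ |e + 1 / 2| * ((k + 1 : ℝ) / (m + 1)) ^ (2 * e + 1) := by
    intro m n h
    have e1 : (k + 1 : ℝ) / (n + 1) = (k + 1) / (m + 1) * ((m + 1) / (n + 1)) := by field_simp
    have e2 : ((k + 1 : ℝ) / (m + 1)) ^ (2 * e + 1) = ((k + 1 : ℝ) / (m + 1)) ^ (e + 1 / 2) *
        ((k + 1 : ℝ) / (m + 1)) ^ (e + 1 / 2) := by
      rw [← Real.rpow_add (by positivity)]; ring_nf
    have e3 : ((m + 1 : ℝ) / (n + 1)) ^ (e + 1 / 2) ≤ 4 ^ |e + 1 / 2| := by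
      refine rpow_le_rpow_abs ?_ ?_ (by norm_num) _
      · rw [le_div_iff₀ (by positivity)]; linarith [h.symm.left]
      · rw [div_le_iff₀ (by positivity)]; exact h.left
    rw [e1, Real.mul_rpow (by positivity) (by positivity), e2]
    calc _ = ((m + 1 : ℝ) / (n + 1)) ^ (e + 1 / 2) * (((k + 1 : ℝ) / (m + 1)) ^ (e + 1 / 2) *
        ((k + 1 : ℝ) / (m + 1)) ^ (e + 1 / 2)) := by ring
      _ ≤ _ := by gcongr
  have ratio' : ((k + 1 : ℝ) / (m + 1)) ^ (e + 1 / 2) * ((k + 1 : ℝ) / (n + 1)) ^ (e + 1 / 2) ≤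
      4 ^ |e + 1 / 2| * ((k + 1 : ℝ) / ((min m n : ℕ) + 1)) ^ (2 * e + 1) := by
    rcases le_total m n with h | h
    · rw [min_eq_left h]; exact ratio m n hmn
    · rw [min_eq_right h, mul_comm]; exact ratio n m hmn.symm
  rw [abs_mul]
  calc _ ≤ (K1 * ((m - k + 1 : ℝ) ^ (s - 1) * ((k + 1 : ℝ) / (m + 1)) ^ (e + 1 / 2))) *
        (K2 * ((n - k + 1 : ℝ) ^ (t - 1) * ((k + 1 : ℝ) / (n + 1)) ^ (e + 1 / 2))) :=
        mul_le_mul (h1 m k hkm) (h2 n k hkn) (abs_nonneg _) (by positivity)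
    _ = K1 * K2 * ((m - k + 1 : ℝ) ^ (s - 1) * (n - k + 1 : ℝ) ^ (t - 1)) *
        (((k + 1 : ℝ) / (m + 1)) ^ (e + 1 / 2) * ((k + 1 : ℝ) / (n + 1)) ^ (e + 1 / 2)) := by ring
    _ ≤ K1 * K2 * ((m - k + 1 : ℝ) ^ (s - 1) * (n - k + 1 : ℝ) ^ (t - 1)) *
        (4 ^ |e + 1 / 2| * ((k + 1 : ℝ) / ((min m n : ℕ) + 1)) ^ (2 * e + 1)) :=
        mul_le_mul_of_nonneg_left ratio' (by positivity)
    _ = _ := by ring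

/-- With m ≤ n, the factor (n-k+1)^{-1/2} is at most (n-m+1)^{-1/2} and leaves the sum; the rest is
the discrete Beta bound. -/
lemma exists_abs_jacobiInt_half_half_le {e b : ℝ} (he : -1 < e) (hb : -1 < b)
    (heb : -3 / 2 < e + b) :
    ∃ K : ℝ, 0 < K ∧ ∀ m n : ℕ, Comparable m n →
      |jacobiInt e b (orthPoly (e + 1 / 2) b m * orthPoly (e + 1 / 2) b n)| ≤
        K * ((m + 1) / (|(m : ℝ) - n| + 1)) := by
  obtain ⟨K1, k1, h1⟩ := exists_abs_jacobiInt_le (s := 1 / 2) (t := 1 / 2) he hb heb.le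
    (by norm_num) (by norm_num) (by linarith) (by linarith)
  obtain ⟨K2, k2, h2⟩ := exists_sum_beta_le (g := 2 * e + 1) (by linarith)
  have key : ∀ m n : ℕ, m ≤ n → Comparable m n →
      |jacobiInt e b (orthPoly (e + 1 / 2) b m * orthPoly (e + 1 / 2) b n)| ≤
        K1 * K2 * 2 * ((m + 1) / (|(m : ℝ) - n| + 1)) := by
    intro m n hle hmn
    have hle' : (m : ℝ) ≤ n := by exact_mod_cast hle
    have habs : |(m : ℝ) - n| = n - m := by rw [abs_sub_comm, abs_of_nonneg (by linarith)]
    have hd := hmn.abs_sub_add_one_le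
    rw [habs] at hd ⊢
    have hd0 : (0 : ℝ) < n - m + 1 := by linarith
    have hsum : ∑ k ∈ Finset.range (m + 1), ((k + 1 : ℝ) / (m + 1)) ^ (2 * e + 1) *
        ((m - k + 1 : ℝ) ^ ((1 / 2 : ℝ) - 1) * (n - k + 1 : ℝ) ^ ((1 / 2 : ℝ) - 1)) ≤
        K2 * √(m + 1 : ℝ) * (n - m + 1 : ℝ) ^ (-(1 / 2) : ℝ) := by
      refine le_trans ?_ (mul_le_mul_of_nonneg_right (h2 m) (by positivity))
      rw [Finset.sum_mul]
      refine Finset.sum_le_sum fun k hk => ?_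
      have hk' : (k : ℝ) ≤ m := by exact_mod_cast Nat.lt_succ_iff.1 (Finset.mem_range.1 hk)
      rw [show (1 / 2 : ℝ) - 1 = -(1 / 2) by norm_num, mul_assoc]
      have c1 : (0 : ℝ) < m - k + 1 := by linarith
      have := Real.rpow_le_rpow_of_nonpos hd0 (by linarith : (n - m + 1 : ℝ) ≤ n - k + 1)
        (by norm_num : (-(1 / 2) : ℝ) ≤ 0)
      gcongr
    have h := h1 m n hmn
    rw [min_eq_left hle] at h
    refine h.trans ((mul_le_mul_of_nonneg_left hsum k1.le).trans ?_)
    -- √(M/D) is at most 2M/D because D ≤ 4M. The weaker form is all that the quotient estimate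
    -- uses.
    have hfin : √(m + 1 : ℝ) * (n - m + 1 : ℝ) ^ (-(1 / 2) : ℝ) ≤ 2 * ((m + 1) / (n - m + 1)) := by
      rw [Real.rpow_neg hd0.le, ← Real.sqrt_eq_rpow, ← div_eq_mul_inv,
        ← Real.sqrt_div (by positivity)]
      refine Real.sqrt_le_iff.2 ⟨by positivity, ?_⟩
      have hr : (1 : ℝ) ≤ 4 * ((m + 1) / (n - m + 1)) := by
        rw [mul_div_assoc', le_div_iff₀ hd0]; linarith
      have : (0 : ℝ) ≤ (m + 1) / (n - m + 1) := by positivity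
      nlinarith
    calc _ = K1 * K2 * (√(m + 1 : ℝ) * (n - m + 1 : ℝ) ^ (-(1 / 2) : ℝ)) := by ring
      _ ≤ K1 * K2 * (2 * ((m + 1) / (n - m + 1))) := by gcongr
      _ = _ := by ring
  refine ⟨K1 * K2 * 2 * 4, by positivity, fun m n hmn => ?_⟩
  have hd0 : 0 ≤ |(m : ℝ) - n| := abs_nonneg _
  rcases le_total m n with h | h
  · refine (key m n h hmn).trans ?_
    have : (0 : ℝ) ≤ (m + 1) / (|(m : ℝ) - n| + 1) := by positivity
    have : 0 < K1 * K2 := by positivity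
    nlinarith
  · rw [mul_comm (orthPoly _ _ m)]
    refine (key n m h hmn.symm).trans ?_
    have := hmn.symm.left
    rw [abs_sub_comm]
    calc _ ≤ K1 * K2 * 2 * (4 * (m + 1) / (|(m : ℝ) - n| + 1)) := by gcongr
      _ = _ := by ring

/-- The exponent 3/2 makes one factor grow like a square root; bounding it by √(n+1) loses all decay
in |m-n| and leaves order m+1. -/
lemma exists_abs_jacobiInt_half_three_halves_le {e b : ℝ} (he : -1 < e) (hb : -1 < b)
    (heb : -3 / 2 < e + b) :
    ∃ K : ℝ, 0 < K ∧ ∀ m n : ℕ, Comparable m n →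
      |jacobiInt e b (orthPoly (e + 1 / 2) b m * orthPoly (e + 3 / 2) b n)| ≤ K * (m + 1) := by
  obtain ⟨K1, k1, h1⟩ := exists_abs_jacobiInt_le (s := 1 / 2) (t := 3 / 2) he hb heb.le
    (by norm_num) (by norm_num) (by linarith) (by linarith)
  obtain ⟨K2, k2, h2⟩ := exists_sum_beta_le (g := 2 * e + 1) (by linarith)
  refine ⟨K1 * K2 * 2, by positivity, fun m n hmn => (h1 m n hmn).trans ?_⟩
  set N := min m n with hN
  have hNm : (N : ℝ) ≤ m := by exact_mod_cast min_le_left m n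
  have hn4 : (n + 1 : ℝ) ≤ 4 * (m + 1) := hmn.symm.left
  have hsum : ∑ k ∈ Finset.range (N + 1), ((k + 1 : ℝ) / (N + 1)) ^ (2 * e + 1) *
      ((m - k + 1 : ℝ) ^ ((1 / 2 : ℝ) - 1) * (n - k + 1 : ℝ) ^ ((3 / 2 : ℝ) - 1)) ≤
      K2 * √(N + 1 : ℝ) * √(n + 1 : ℝ) := by
    refine le_trans ?_ (mul_le_mul_of_nonneg_right (h2 N) (by positivity))
    rw [Finset.sum_mul]
    refine Finset.sum_le_sum fun k hk => ?_
    have hkN := Nat.lt_succ_iff.1 (Finset.mem_range.1 hk)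
    have hk' : (k : ℝ) ≤ N := by exact_mod_cast hkN
    have hkn : (k : ℝ) ≤ n := by exact_mod_cast hkN.trans (min_le_right m n)
    have hk0 : (0 : ℝ) ≤ k := by positivity
    rw [show (1 / 2 : ℝ) - 1 = -(1 / 2) by norm_num, show (3 / 2 : ℝ) - 1 = 1 / 2 by norm_num,
      mul_assoc, ← Real.sqrt_eq_rpow]
    have c1 : (0 : ℝ) < N - k + 1 := by linarith
    have := Real.rpow_le_rpow_of_nonpos c1 (by linarith : (N - k + 1 : ℝ) ≤ m - k + 1)
      (by norm_num : (-(1 / 2) : ℝ) ≤ 0)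
    have : √(n - k + 1 : ℝ) ≤ √(n + 1 : ℝ) := Real.sqrt_le_sqrt (by linarith)
    gcongr
  refine (mul_le_mul_of_nonneg_left hsum k1.le).trans ?_
  have s1 : √(N + 1 : ℝ) ≤ √(m + 1 : ℝ) := Real.sqrt_le_sqrt (by linarith)
  have s2 : √(n + 1 : ℝ) ≤ 2 * √(m + 1 : ℝ) := by
    refine (Real.sqrt_le_sqrt hn4).trans (le_of_eq ?_)
    rw [Real.sqrt_mul (by norm_num), show (4 : ℝ) = 2 ^ 2 by norm_num, Real.sqrt_sq (by norm_num)]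
  calc _ ≤ K1 * (K2 * √(m + 1 : ℝ) * (2 * √(m + 1 : ℝ))) := by gcongr
    _ = K1 * K2 * 2 * (√(m + 1 : ℝ) * √(m + 1 : ℝ)) := by ring
    _ = _ := by rw [Real.mul_self_sqrt (by positivity)]

/-! ### Bounds for the edge functional -/

/-- At x = 1 the derivative term of `raise` vanishes, so each raising multiplies the value by
-2(a+1). -/
lemma eval_one_rodrigues (n : ℕ) : ∀ a b : ℝ,
    (rodrigues n a b).eval 1 = (-2) ^ n * (ascPochhammer ℝ n).eval (a + 1) := by
  induction n with
  | zero => intro a b; simp [rodrigues]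
  | succ n ih =>
    intro a b
    rw [ascPochhammer_eval_succ_left, rodrigues, raise]
    simp only [eval_add, eval_mul, eval_sub, eval_pow, eval_one, eval_X, eval_C, ih]
    ring

lemma exists_abs_eval_one_orthPoly_le {a b : ℝ} (ha : -1 < a) (hb : -1 < b)
    (hab : -3 / 2 ≤ a + b) :
    ∃ K : ℝ, 0 < K ∧ ∀ n : ℕ, |(orthPoly a b n).eval 1| ≤ K * (n + 1 : ℝ) ^ (a + 1 / 2) := by
  obtain ⟨K1, k1, h1⟩ := exists_Gamma_div_factorial_le (by linarith : 0 < a + 1)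
  obtain ⟨K2, k2, h2⟩ := exists_inv_normSq_le ha hb hab
  have g := Real.Gamma_pos_of_pos (by linarith : 0 < a + 1)
  generalize hG : Real.Gamma (a + 1) = G at g
  refine ⟨√K2 * (K1 * G⁻¹), by positivity, fun n => ?_⟩
  have p := normSq_pos ha hb n
  have pg : 0 < Real.Gamma (n + (a + 1)) :=
    Real.Gamma_pos_of_pos (by linarith [(Nat.cast_nonneg n : (0 : ℝ) ≤ n)])
  have e1 : (orthPoly a b n).eval 1 = √(normSq a b n)⁻¹ *
      (Real.Gamma (n + (a + 1)) / n.factorial * G⁻¹) := by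
    rw [orthPoly, jacobiPoly, eval_mul, eval_mul, eval_C, eval_C, eval_one_rodrigues,
      ascPochhammer_eval_eq_Gamma (by linarith), hG, Real.sqrt_inv]
    have : (-1 : ℝ) ^ n * (-2) ^ n = 2 ^ n := by rw [← mul_pow]; norm_num
    congr 1
    field_simp
    linear_combination this
  have s1 : √(normSq a b n)⁻¹ ≤ √K2 * √(n + 1 : ℝ) := by
    rw [← Real.sqrt_mul k2.le]; exact Real.sqrt_le_sqrt (h2 n)
  rw [e1, abs_of_nonneg (by positivity)]
  calc _ ≤ (√K2 * √(n + 1 : ℝ)) * (K1 * (n + 1 : ℝ) ^ (a + 1 - 1) * G⁻¹) := by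
        gcongr
        exact h1 n
    _ = _ := by
        rw [Real.rpow_add (by positivity) a, Real.sqrt_eq_rpow (n + 1 : ℝ),
          show a + 1 - 1 = a by ring]
        ring

/-- For α > -1/2 the product bound applies with e = α-1/2 > -1. At α = -1/2 that weight is not
integrable, and endpoint values of order 1 and n+1 take its place. -/
lemma exists_abs_edgeInt_mixed_le {α β : ℝ} (hα : -1 / 2 ≤ α) (hβ : -1 / 2 ≤ β) :
    ∃ K : ℝ, 0 < K ∧ ∀ m n : ℕ, Comparable m n →
      |edgeInt α β (orthPoly α β m * orthPoly (α + 1) β n)| ≤ K * (m + 1) := by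
  have hβ' : -1 < β := by linarith
  rcases hα.eq_or_lt with rfl | h
  · obtain ⟨K1, k1, h1⟩ := exists_abs_eval_one_orthPoly_le (a := -1 / 2) (by norm_num) hβ'
      (by linarith)
    obtain ⟨K2, k2, h2⟩ := exists_abs_eval_one_orthPoly_le (a := -1 / 2 + 1) (by norm_num) hβ'
      (by linarith)
    refine ⟨2 ^ β * (K1 * (K2 * 4)), by positivity, fun m n hmn => ?_⟩
    have a1 := h1 m
    have a2 := h2 n
    rw [show (-1 / 2 + 1 / 2 : ℝ) = 0 by norm_num, Real.rpow_zero, mul_one] at a1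
    rw [show (-1 / 2 + 1 + 1 / 2 : ℝ) = 1 by norm_num, Real.rpow_one] at a2
    have hc : (n + 1 : ℝ) ≤ 4 * (m + 1) := hmn.symm.left
    rw [edgeInt_neg_half hβ', abs_mul, abs_of_pos (by positivity : (0 : ℝ) < 2 ^ β), eval_mul,
      abs_mul, mul_assoc]
    refine mul_le_mul_of_nonneg_left ?_ (by positivity)
    calc _ ≤ K1 * (K2 * (n + 1)) := mul_le_mul a1 a2 (abs_nonneg _) k1.le
      _ ≤ K1 * (K2 * (4 * (m + 1))) := by gcongr
      _ = _ := by ring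
  · obtain ⟨K, k, hK⟩ := exists_abs_jacobiInt_half_three_halves_le (e := α - 1 / 2)
      (by linarith) hβ' (by linarith)
    have hc : 0 < α + 1 / 2 := by linarith
    refine ⟨(α + 1 / 2) * K, by positivity, fun m n hmn => ?_⟩
    have := hK m n hmn
    rw [show α - 1 / 2 + 1 / 2 = α by ring, show α - 1 / 2 + 3 / 2 = α + 1 by ring] at this
    rw [edgeInt_eq h hβ', abs_mul, abs_of_pos hc, mul_assoc]
    gcongr

lemma exists_abs_edgeInt_same_le {α β : ℝ} (hα : -1 / 2 ≤ α) (hβ : -1 / 2 ≤ β) :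
    ∃ K : ℝ, 0 < K ∧ ∀ m n : ℕ, Comparable m n →
      |edgeInt α β (orthPoly α β m * orthPoly α β n)| ≤
        K * ((m + 1) / (|(m : ℝ) - n| + 1)) := by
  have hβ' : -1 < β := by linarith
  rcases hα.eq_or_lt with rfl | h
  · obtain ⟨K1, k1, h1⟩ := exists_abs_eval_one_orthPoly_le (a := -1 / 2) (by norm_num) hβ'
      (by linarith)
    refine ⟨2 ^ β * (K1 * (K1 * 4)), by positivity, fun m n hmn => ?_⟩
    have a1 := h1 m
    have a2 := h1 n
    rw [show (-1 / 2 + 1 / 2 : ℝ) = 0 by norm_num, Real.rpow_zero, mul_one] at a1 a2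
    have hd := hmn.abs_sub_add_one_le
    have hd0 : 0 ≤ |(m : ℝ) - n| := abs_nonneg _
    have hr : 1 ≤ 4 * ((m + 1) / (|(m : ℝ) - n| + 1)) := by
      rw [mul_div_assoc', le_div_iff₀ (by positivity)]; linarith
    rw [edgeInt_neg_half hβ', abs_mul, abs_of_pos (by positivity : (0 : ℝ) < 2 ^ β), eval_mul,
      abs_mul, mul_assoc]
    refine mul_le_mul_of_nonneg_left ?_ (by positivity)
    calc _ ≤ K1 * (K1 * 1) := by rw [mul_one]; exact mul_le_mul a1 a2 (abs_nonneg _) k1.le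
      _ ≤ K1 * (K1 * (4 * ((m + 1) / (|(m : ℝ) - n| + 1)))) := by gcongr
      _ = _ := by ring
  · obtain ⟨K, k, hK⟩ := exists_abs_jacobiInt_half_half_le (e := α - 1 / 2)
      (by linarith) hβ' (by linarith)
    have hc : 0 < α + 1 / 2 := by linarith
    refine ⟨(α + 1 / 2) * K, by positivity, fun m n hmn => ?_⟩
    have := hK m n hmn
    rw [show α - 1 / 2 + 1 / 2 = α by ring] at this
    rw [edgeInt_eq h hβ', abs_mul, abs_of_pos hc, mul_assoc]
    gcongr

lemma exists_abs_jacobiInt_raised_le {α β : ℝ} (hα : -1 / 2 ≤ α) (hβ : -1 / 2 ≤ β) :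
    ∃ K : ℝ, 0 < K ∧ ∀ m n : ℕ, Comparable m n →
      |(α + 1 / 2) * jacobiInt (α + 1 / 2) β (orthPoly (α + 1) β m * orthPoly (α + 1) β n)| ≤
        K * ((m + 1) / (|(m : ℝ) - n| + 1)) := by
  obtain ⟨K, k, hK⟩ := exists_abs_jacobiInt_half_half_le (e := α + 1 / 2) (b := β)
    (by linarith) (by linarith) (by linarith)
  -- The factor α+1 replaces α+1/2 so that the constant stays positive at α = -1/2.
  refine ⟨(α + 1) * K, mul_pos (by linarith) k, fun m n hmn => ?_⟩
  have := hK m n hmn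
  rw [show α + 1 / 2 + 1 / 2 = α + 1 by ring] at this
  rw [abs_mul, abs_of_nonneg (by linarith : 0 ≤ α + 1 / 2), mul_assoc]
  exact mul_le_mul (by linarith) this (abs_nonneg _) (by linarith)

/-! ### From bounds on numerators to differences of the kernel -/

/-- Difference of two quotients `i₁ / q₁ - i₂ / q₂` when numerators almost agree up to weights
`u`, `v` close to a common `κ`. -/
lemma abs_div_sub_div_le {M D κ c C1 C2 C3 C4 i1 i2 q1 q2 u v : ℝ} (hM : 0 < M) (hD : 1 ≤ D)
    (hκ : 0 < κ) (hc : 0 < c) (hC1 : 0 < C1) (hC4 : 0 < C4)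
    (hq1 : c * (M * D) ≤ |q1|) (hq2 : c * (M * D) ≤ |q2|) (hi1 : |i1| ≤ C1 * M)
    (hi2 : |i2| ≤ C1 * M) (hη : |u * i1 - v * i2| ≤ C2 * (M / D)) (hq : |q2 - q1| ≤ C3 * M)
    (hu : |u - κ| ≤ C4 / D) (hv : |v - κ| ≤ C4 / D) :
    |i1 / q1 - i2 / q2| ≤
      ((C2 / c + (κ + C4) * C1 * C3 / c ^ 2 + 2 * (C4 * C1 / c)) / κ) / D ^ 2 := by
  have hD0 : 0 < D := by linarith
  have p : 0 < c * (M * D) := by positivity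
  have pq1 : 0 < |q1| := p.trans_le hq1
  have pq2 : 0 < |q2| := p.trans_le hq2
  have nq1 : q1 ≠ 0 := abs_pos.1 pq1
  have nq2 : q2 ≠ 0 := abs_pos.1 pq2
  have hC2 : 0 ≤ C2 * (M / D) := (abs_nonneg _).trans hη
  have hC3 : 0 ≤ C3 * M := (abs_nonneg _).trans hq
  have hv' : |v| ≤ κ + C4 := by
    have : C4 / D ≤ C4 := div_le_self hC4.le hD
    calc |v| = |(v - κ) + κ| := by ring_nf
      _ ≤ |v - κ| + |κ| := abs_add_le _ _
      _ ≤ _ := by rw [abs_of_pos hκ]; linarith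
  have b1 : |(u * i1 - v * i2) / q1| ≤ C2 / c / D ^ 2 := by
    rw [abs_div]
    calc _ ≤ C2 * (M / D) / (c * (M * D)) := by gcongr
      _ = _ := by field_simp
  have b2 : |v * i2 * (q2 - q1) / (q1 * q2)| ≤ (κ + C4) * C1 * C3 / c ^ 2 / D ^ 2 := by
    rw [abs_div, abs_mul, abs_mul, abs_mul]
    calc _ ≤ (κ + C4) * (C1 * M) * (C3 * M) / (c * (M * D) * (c * (M * D))) := by gcongr
      _ = _ := by field_simp
  have b3 : ∀ w i q : ℝ, |w| ≤ C4 / D → |i| ≤ C1 * M → c * (M * D) ≤ |q| →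
      |w * (i / q)| ≤ C4 * C1 / c / D ^ 2 := by
    intro w i q hw hi hq
    rw [abs_mul, abs_div]
    calc _ ≤ C4 / D * (C1 * M / (c * (M * D))) := by gcongr
      _ = _ := by field_simp
  have b4 := b3 _ _ _ hu hi1 hq1
  have b5 := b3 _ _ _ hv hi2 hq2
  -- The four terms are the near-cancellation of the numerators, the change of denominator, and the
  -- two deviations of the weights from κ. Each is O(1/D²).
  have key : κ * (i1 / q1 - i2 / q2) = (u * i1 - v * i2) / q1 + v * i2 * (q2 - q1) / (q1 * q2) -
      (u - κ) * (i1 / q1) + (v - κ) * (i2 / q2) := by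
    field_simp; ring
  have tot : κ * |i1 / q1 - i2 / q2| ≤ C2 / c / D ^ 2 + (κ + C4) * C1 * C3 / c ^ 2 / D ^ 2 +
      C4 * C1 / c / D ^ 2 + C4 * C1 / c / D ^ 2 := by
    rw [← abs_of_pos hκ, ← abs_mul, abs_of_pos hκ, key]
    refine (abs_add_le _ _).trans (add_le_add ((abs_sub _ _).trans
      (add_le_add ((abs_add_le _ _).trans (add_le_add b1 b2)) b4)) b5)
  rw [← mul_le_mul_iff_right₀ hκ]
  refine tot.trans (le_of_eq ?_)
  field_simp
  ring

/-- The gap between the eigenvalues of the two Jacobi equations. -/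
noncomputable def gap (α β : ℝ) (m n : ℕ) : ℝ := (n - m + 1 / 2 : ℝ) * (n + m + α + β + 3 / 2)

/-- The shift by 1/2 keeps the first factor away from zero for integers, including m = n; the second
is at least (m+1)/2 because α+β ≥ -1. -/
lemma le_abs_gap {α β : ℝ} (hα : -1 / 2 ≤ α) (hβ : -1 / 2 ≤ β) (m n : ℕ) :
    1 / 8 * ((m + 1) * (|(m : ℝ) - n| + 1)) ≤ |gap α β m n| := by
  have hm : (0 : ℝ) ≤ m := by positivity
  have hn : (0 : ℝ) ≤ n := by positivity
  have h1 : (|(m : ℝ) - n| + 1) / 4 ≤ |(n - m + 1 / 2 : ℝ)| := by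
    rcases lt_or_ge n m with h | h
    · have : (n : ℝ) + 1 ≤ m := by exact_mod_cast h
      rw [abs_of_pos (by linarith), abs_of_neg (by linarith)]; linarith
    · have : (m : ℝ) ≤ n := by exact_mod_cast h
      rw [abs_of_nonpos (by linarith), abs_of_pos (by linarith)]; linarith
  have h2 : (m + 1 : ℝ) / 2 ≤ |(n + m + α + β + 3 / 2 : ℝ)| := by
    rw [abs_of_pos (by linarith)]; linarith
  rw [gap, abs_mul]
  calc _ = (|(m : ℝ) - n| + 1) / 4 * ((m + 1 : ℝ) / 2) := by ring
    _ ≤ _ := by gcongr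

lemma gap_ne_zero {α β : ℝ} (hα : -1 / 2 ≤ α) (hβ : -1 / 2 ≤ β) (m n : ℕ) : gap α β m n ≠ 0 :=
  abs_pos.1 (lt_of_lt_of_le (by positivity) (le_abs_gap hα hβ m n))

lemma rieszKernel_eq_edgeInt_div_gap {α β : ℝ} (hα : -1 / 2 ≤ α) (hβ : -1 / 2 ≤ β) (m n : ℕ) :
    rieszKernel α β m n = edgeInt α β (orthPoly α β m * orthPoly (α + 1) β n) / gap α β m n := by
  rw [eq_div_iff (gap_ne_zero hα hβ m n), ← jacobiInt_eq_edgeInt hα (by linarith),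
    rieszKernel_eq (by linarith) (by linarith), gap, mul_comm]

lemma div_succ_le {c : ℝ} (hc : 0 < c) {m n : ℕ} (h : Comparable m n) :
    c / (m + 1) ≤ 4 * c / (|(m : ℝ) - n| + 1) := by
  have := h.abs_sub_add_one_le
  have hd : 0 ≤ |(m : ℝ) - n| := abs_nonneg _
  rw [div_le_div_iff₀ (by positivity) (by positivity)]
  nlinarith

lemma exists_abs_rieszKernel_succ_right_sub_le {α β : ℝ} (hα : -1 / 2 ≤ α) (hβ : -1 / 2 ≤ β) :
    ∃ C : ℝ, 0 < C ∧ ∀ m n : ℕ, Comparable m n → Comparable m (n + 1) →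
      |rieszKernel α β m (n + 1) - rieszKernel α β m n| ≤ C / (|(m : ℝ) - n| + 1) ^ 2 := by
  obtain ⟨K1, k1, h1⟩ := exists_abs_edgeInt_mixed_le hα hβ
  obtain ⟨K2, k2, h2⟩ := exists_abs_edgeInt_same_le hα hβ
  obtain ⟨K3, k3, h3⟩ := diagCoeff_asymp hα hβ
  obtain ⟨K4, k4, h4⟩ := offCoeff_asymp hα hβ
  have hκ : 0 < √(1 / 2 : ℝ) := Real.sqrt_pos.2 (by norm_num)
  -- With D = |m-n|+1, moving n to n+1 changes D by at most a factor 2. This halves 1/8 to 1/16 and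
  -- doubles K2; the factor 4 on K3+K4 comes from D ≤ 4(n+1).
  refine ⟨(2 * K2 / (1 / 16) + (√(1 / 2) + 4 * (K3 + K4)) * K1 * (11 + |α| + |β|) / (1 / 16) ^ 2 +
    2 * (4 * (K3 + K4) * K1 / (1 / 16))) / √(1 / 2), by positivity, fun m n hmn hmn' => ?_⟩
  have hm : (0 : ℝ) ≤ m := by positivity
  have hn : (0 : ℝ) ≤ n := by positivity
  have hd : 0 ≤ |(m : ℝ) - n| := abs_nonneg _
  have hd' : |(m : ℝ) - n| ≤ |(m : ℝ) - (n + 1 : ℕ)| + 1 := by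
    push_cast
    calc |(m : ℝ) - n| = |(m - (n + 1) : ℝ) + 1| := by ring_nf
      _ ≤ |(m - (n + 1) : ℝ)| + |(1 : ℝ)| := abs_add_le _ _
      _ = _ := by rw [abs_one]
  have hd2 : 0 ≤ |(m : ℝ) - (n + 1 : ℕ)| := abs_nonneg _
  rw [rieszKernel_eq_edgeInt_div_gap hα hβ, rieszKernel_eq_edgeInt_div_gap hα hβ]
  have g1 := le_abs_gap hα hβ m n
  have g2 := le_abs_gap hα hβ m (n + 1)
  have c1 := div_succ_le (by positivity : 0 < K3 + K4) hmn.symm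
  rw [abs_sub_comm] at c1
  refine abs_div_sub_div_le (M := m + 1) (u := diagCoeff α β (n + 1)) (v := offCoeff α β n)
    (by positivity) (by linarith) hκ (by norm_num) k1 (by positivity) ?_ ?_ (h1 m (n + 1) hmn')
    (h1 m n hmn) ?_ ?_ ?_ ?_
  · nlinarith
  · nlinarith
  · rw [← edgeInt_C_mul, ← edgeInt_C_mul, ← edgeInt_sub hα (by linarith)]
    have e : C (diagCoeff α β (n + 1)) * (orthPoly α β m * orthPoly (α + 1) β (n + 1)) -
        C (offCoeff α β n) * (orthPoly α β m * orthPoly (α + 1) β n) =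
        orthPoly α β m * orthPoly α β (n + 1) := by
      rw [orthPoly_succ_eq (a := α) (by linarith) (by linarith)]; ring
    rw [e]
    refine (h2 m (n + 1) hmn').trans ?_
    rw [mul_comm 2 K2, mul_assoc]
    refine mul_le_mul_of_nonneg_left ?_ k2.le
    rw [mul_div_assoc', div_le_div_iff₀ (by positivity) (by positivity)]
    nlinarith
  · have e : gap α β m n - gap α β m (n + 1) = -(2 * n + α + β + 3) := by
      simp only [gap]; push_cast; ring
    have := hmn.symm.left
    have a1 := le_abs_self α
    have a2 := le_abs_self β
    have a3 := abs_nonneg α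
    have a4 := abs_nonneg β
    rw [e, abs_neg, abs_of_pos (by linarith)]
    nlinarith
  · refine (h3 (n + 1) (by omega)).trans (le_trans ?_ c1)
    push_cast
    rw [div_le_div_iff₀ (by positivity) (by positivity)]
    nlinarith
  · refine (h4 n).trans (le_trans ?_ c1)
    gcongr
    linarith

lemma exists_abs_rieszKernel_succ_left_sub_le {α β : ℝ} (hα : -1 / 2 ≤ α) (hβ : -1 / 2 ≤ β) :
    ∃ C : ℝ, 0 < C ∧ ∀ m n : ℕ, 1 ≤ m → Comparable m n → Comparable (m + 1) n →
      |rieszKernel α β (m + 1) n - rieszKernel α β m n| ≤ C / (|(m : ℝ) - n| + 1) ^ 2 := by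
  obtain ⟨K1, k1, h1⟩ := exists_abs_edgeInt_mixed_le hα hβ
  obtain ⟨K2, k2, h2⟩ := exists_abs_jacobiInt_raised_le hα hβ
  obtain ⟨K3, k3, h3⟩ := diagCoeff_asymp hα hβ
  obtain ⟨K4, k4, h4⟩ := offCoeff_asymp hα hβ
  have hκ : 0 < √(1 / 2 : ℝ) := Real.sqrt_pos.2 (by norm_num)
  -- K1 is doubled because the numerator at m+1 is bounded by K1(m+2) ≤ 2K1(m+1); K2 is not, since
  -- the combined numerator involves exactly the degrees m and n.
  refine ⟨(K2 / (1 / 16) + (√(1 / 2) + 4 * (K3 + K4)) * (2 * K1) * (2 + |α| + |β|) / (1 / 16) ^ 2 +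
    2 * (4 * (K3 + K4) * (2 * K1) / (1 / 16))) / √(1 / 2), by positivity,
    fun m n h1m hmn hmn' => ?_⟩
  have hm : (0 : ℝ) ≤ m := by positivity
  have hn : (0 : ℝ) ≤ n := by positivity
  have hd : 0 ≤ |(m : ℝ) - n| := abs_nonneg _
  have hd' : |(m : ℝ) - n| ≤ |((m + 1 : ℕ) : ℝ) - n| + 1 := by
    push_cast
    calc |(m : ℝ) - n| = |(m + 1 - n : ℝ) - 1| := by ring_nf
      _ ≤ |(m + 1 - n : ℝ)| + |(1 : ℝ)| := abs_sub _ _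
      _ = _ := by rw [abs_one]
  have hd2 : 0 ≤ |((m + 1 : ℕ) : ℝ) - n| := abs_nonneg _
  -- The swap puts the index m first, matching the order d_m q_m - o_m q_{m+1} of the contiguity
  -- relation.
  rw [rieszKernel_eq_edgeInt_div_gap hα hβ, rieszKernel_eq_edgeInt_div_gap hα hβ, abs_sub_comm]
  have g1 := le_abs_gap hα hβ m n
  have g2 := le_abs_gap hα hβ (m + 1) n
  have c1 := div_succ_le (by positivity : 0 < K3 + K4) hmn
  refine abs_div_sub_div_le (M := m + 1) (u := diagCoeff α β m) (v := offCoeff α β m)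
    (by positivity) (by linarith) hκ (by norm_num) (by positivity) (by positivity) ?_ ?_ ?_ ?_
    ?_ ?_ ?_ ?_
  · nlinarith
  · refine le_trans ?_ g2
    push_cast at hd2 hd' ⊢
    nlinarith
  · refine (h1 m n hmn).trans ?_
    nlinarith
  · refine (h1 (m + 1) n hmn').trans ?_
    push_cast
    nlinarith
  · rw [← edgeInt_C_mul, ← edgeInt_C_mul, ← edgeInt_sub hα (by linarith)]
    have e : C (diagCoeff α β m) * (orthPoly α β m * orthPoly (α + 1) β n) -
        C (offCoeff α β m) * (orthPoly α β (m + 1) * orthPoly (α + 1) β n) =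
        (1 - X) * (orthPoly (α + 1) β m * orthPoly (α + 1) β n) := by
      rw [← mul_assoc (1 - X), one_sub_mul_orthPoly (by linarith) (by linarith)]; ring
    rw [e, edgeInt_one_sub_mul hα (by linarith)]
    exact h2 m n hmn
  · have e : gap α β (m + 1) n - gap α β m n = -(2 * m + α + β + 2) := by
      simp only [gap]; push_cast; ring
    have a1 := le_abs_self α
    have a2 := le_abs_self β
    have a3 := abs_nonneg α
    have a4 := abs_nonneg β
    rw [e, abs_neg, abs_of_nonneg (by linarith)]
    nlinarith
  · refine (h3 m h1m).trans (le_trans ?_ c1)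
    gcongr
    linarith
  · refine (h4 m).trans (le_trans ?_ c1)
    gcongr
    linarith

lemma div_sq_add_div_sq_le {C x y z : ℝ} (hC : 0 < C) (hz : 0 < z) (hx : z ≤ x)
    (hzy : z ≤ y + 1) : C / (x + 1) ^ 2 + C / (y + 1) ^ 2 ≤ 2 * C / z ^ 2 := by
  have h1 : C / (x + 1) ^ 2 ≤ C / z ^ 2 := by gcongr; linarith
  have h2 : C / (y + 1) ^ 2 ≤ C / z ^ 2 := by gcongr
  calc _ ≤ C / z ^ 2 + C / z ^ 2 := add_le_add h1 h2
    _ = _ := by ring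

end JacobiRiesz

theorem proposition4p2 (α β : ℝ) (hα : -1 / 2 ≤ α) (hβ : -1 / 2 ≤ β) :
    ∃ C : ℝ, 0 < C ∧ ∀ m n : ℕ, n ≠ m → (m : ℝ) / 2 ≤ (n : ℝ) → (n : ℝ) ≤ 3 * (m : ℝ) / 2 →
      |JacobiRiesz.rieszKernel α β (m + 2) n - JacobiRiesz.rieszKernel α β m n|
          ≤ C / |(m : ℝ) - (n : ℝ)| ^ 2 ∧
      |JacobiRiesz.rieszKernel α β m (n + 2) - JacobiRiesz.rieszKernel α β m n|
          ≤ C / |(m : ℝ) - (n : ℝ)| ^ 2 := by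
  obtain ⟨C1, c1, h1⟩ := JacobiRiesz.exists_abs_rieszKernel_succ_left_sub_le hα hβ
  obtain ⟨C2, c2, h2⟩ := JacobiRiesz.exists_abs_rieszKernel_succ_right_sub_le hα hβ
  refine ⟨2 * C1 + 2 * C2, by positivity, fun m n hne hl hu => ?_⟩
  have hl' : m ≤ 2 * n := by
    have : (m : ℝ) ≤ 2 * n := by linarith
    exact_mod_cast this
  have hu' : 2 * n ≤ 3 * m := by
    have : (2 * n : ℝ) ≤ 3 * m := by linarith
    exact_mod_cast this
  -- If m = 0, the range condition forces n = 0 = m, which is excluded.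
  have hm : 1 ≤ m := by omega
  have hz : 0 < |(m : ℝ) - n| := abs_pos.2 (sub_ne_zero.2 (by exact_mod_cast hne.symm))
  constructor
  · have s1 := h1 m n hm ⟨by omega, by omega⟩ ⟨by omega, by omega⟩
    have s2 := h1 (m + 1) n (by omega) ⟨by omega, by omega⟩ ⟨by omega, by omega⟩
    have hd : |(m : ℝ) - n| ≤ |((m + 1 : ℕ) : ℝ) - n| + 1 := by
      push_cast
      calc |(m : ℝ) - n| = |(m + 1 - n : ℝ) - 1| := by ring_nf
        _ ≤ |(m + 1 - n : ℝ)| + |(1 : ℝ)| := abs_sub _ _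
        _ = _ := by rw [abs_one]
    -- The intermediate index may be one closer to the diagonal; the +1 in the one-step bound
    -- compensates exactly, so |m-n| serves for both steps.
    have := JacobiRiesz.div_sq_add_div_sq_le c1 hz le_rfl hd
    calc _ ≤ |JacobiRiesz.rieszKernel α β (m + 1 + 1) n - JacobiRiesz.rieszKernel α β (m + 1) n| +
          |JacobiRiesz.rieszKernel α β (m + 1) n - JacobiRiesz.rieszKernel α β m n| :=
          abs_sub_le _ _ _
      _ ≤ 2 * C1 / |(m : ℝ) - n| ^ 2 := by linarith
      _ ≤ _ := by gcongr; linarith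
  · have s1 := h2 m n ⟨by omega, by omega⟩ ⟨by omega, by omega⟩
    have s2 := h2 m (n + 1) ⟨by omega, by omega⟩ ⟨by omega, by omega⟩
    have hd : |(m : ℝ) - n| ≤ |(m : ℝ) - (n + 1 : ℕ)| + 1 := by
      push_cast
      calc |(m : ℝ) - n| = |(m - (n + 1) : ℝ) + 1| := by ring_nf
        _ ≤ |(m - (n + 1) : ℝ)| + |(1 : ℝ)| := abs_add_le _ _
        _ = _ := by rw [abs_one]
    have := JacobiRiesz.div_sq_add_div_sq_le c2 hz le_rfl hd
    calc _ ≤ |JacobiRiesz.rieszKernel α β m (n + 1 + 1) - JacobiRiesz.rieszKernel α β m (n + 1)| +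
          |JacobiRiesz.rieszKernel α β m (n + 1) - JacobiRiesz.rieszKernel α β m n| :=
          abs_sub_le _ _ _
      _ ≤ 2 * C2 / |(m : ℝ) - n| ^ 2 := by linarith
      _ ≤ _ := by gcongr; linarith
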